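/- Let $\Omega=\{\omega\in C([0,1],\mathbb R^d):\omega(0)=0\}$ with canonical process $B$ and raw filtration $\mathbb F=(\mathcal F_t)_{0\le t\le 1}$, $\mathcal F_t=\sigma(B_s,s\le t)$. Let $\underline a\le\overline a$ be symmetric $d\times d$ matrices with $\underline a\ge 0$ and $\overline a>0$ (positive definite). For a symmetric matrix $A=\sum_k\lambda_k\,\nu_k\otimes\nu_k$ (orthonormal eigenvectors $\nu_k$) put $A\vee cI_d=\sum_k(\lambda_k\vee c)\,\nu_k\otimes\nu_k$. Let $\mathcal P$ be the set of probability measures $\mathbb P$ on $(\Omega,\mathcal F_1)$ under which $B$ is a martingale whose quadratic variation is absolutely continuous and satisfies, for some constant $c=c(\mathbb P)>0$, $$ \underline a\vee cI_d\ \le\ \frac{d\langle B\rangle_t}{dt}\ \le\ \overline a\qquad \text{for a.e. } t\in[0,1],\ \mathbb P\text{-a.s.} $$ A property holds quasi-surely if it holds $\mathbb P$-a.s. for every $\mathbb P\in\mathcal P$. For an $\mathbb R^d$-valued integrand $H$ and a real process $Y$ put $$\|H\|_{\mathbb H^2_{\mathcal P}}^2=\sup_{\mathbb P\in\mathcal P}\mathbb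 E^{\mathbb P}\Big[\int_0^1 d\langle B\rangle_tH_t\cdot H_t\Big],\qquad \|Y\|_{\mathbb S^2_{\mathcal P}}^2=\sup_{\mathbb P\in\mathcal P}\mathbb E^{\mathbb P}\Big[\operatorname*{ess\,sup}_{0\le t\le 1}|Y_t|^2\Big]$$ (with $\sup\emptyset=0$). Let $\mathbb H^2_{\mathcal P}$ be the set of $\mathbb F$-progressively measurable $H$ with $\|H\|_{\mathbb H^2_{\mathcal P}}<\infty$, and $\mathbb I^2_{\mathcal P}$ the set of $\mathbb F$-progressively measurable $K$ with $\|K\|_{\mathbb S^2_{\mathcal P}}<\infty$ that quasi-surely are continuous and non-decreasing with $K_0=0$. For $(H,K)\in\mathbb H^2_{\mathcal P}\times\mathbb I^2_{\mathcal P}$ and a constant $M_0\in\mathbb R$, let $$ M_t=M_0+\int_0^tH_s\,dB_s-K_t,\qquad 0\le t\le 1, $$ where the Itô integral, and hence $M=M^{\mathbb P}$, is taken under each $\mathbb P\in\mathcal P$; in $\|M\|_{\mathbb S^2_{\mathcal P}}$ the expectation under $\mathbb P$ is that of $M^{\mathbb P}$. **Proposition.** There is a constant $C$ depending only on the dimension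 $d$ such that the following hold for all such $\underline a,\overline a$. (One process.) If $M$ is given as above by $M_0\in\mathbb R$ and $(H,K)\in\mathbb H^2_{\mathcal P}\times\mathbb I^2_{\mathcal P}$, then $$\|H\|_{\mathbb H^2_{\mathcal P}}+\|K\|_{\mathbb S^2_{\mathcal P}}\le C\,\|M\|_{\mathbb S^2_{\mathcal P}} .$$ (Differences.) If $M^i$ is given as above by $M^i_0\in\mathbb R$ and $(H^i,K^i)\in\mathbb H^2_{\mathcal P}\times\mathbb I^2_{\mathcal P}$ for $i=1,2$, and $\delta M=M^1-M^2$, $\delta H=H^1-H^2$, $\delta K=K^1-K^2$, then $$\|\delta H\|^2_{\mathbb H^2_{\mathcal P}}+\|\delta K\|^2_{\mathbb S^2_{\mathcal P}}\le C\Big[\|\delta M\|^2_{\mathbb S^2_{\mathcal P}}+\|\delta M\|_{\mathbb S^2_{\mathcal P}}\big(\|K^1\|_{\mathbb S^2_{\mathcal P}}+\|K^2\|_{\mathbb S^2_{\mathcal P}}\big)\Big].$$ -/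

import Mathlib

open MeasureTheory Filter Topology
open scoped ENNReal NNReal Matrix unitInterval

noncomputable section

namespace GMart

/-- The canonical space `Ω = {ω ∈ C([0,1], ℝ^d) : ω 0 = 0}`. (Only the topology of `ℝ^d` matters in
what follows, so `ℝ^d` is `Fin d → ℝ`.) -/
def PathSpace (d : ℕ) : Type := {ω : C(I, Fin d → ℝ) // ω 0 = 0}

/-- The canonical process `B`. -/
def B {d : ℕ} (t : I) (ω : PathSpace d) : Fin d → ℝ := ω.1 t

/-- The σ-algebra on `Ω` is the one generated by the canonical process. -/
instance (d : ℕ) : MeasurableSpace (PathSpace d) :=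
  ⨆ t : I, MeasurableSpace.comap (B t) inferInstance

/-- The raw (not augmented) filtration `F_t = σ(B_s, s ≤ t)`, `t ∈ [0,1]`. -/
def canonicalFiltration (d : ℕ) :
    Filtration I (inferInstance : MeasurableSpace (PathSpace d)) where
  seq t := ⨆ s : I, ⨆ _ : s ≤ t, MeasurableSpace.comap (B s) inferInstance
  mono' _ _ h := iSup_mono fun _ => iSup_mono' fun hs => ⟨hs.trans h, le_rfl⟩
  le' _ := iSup_mono fun _ => iSup_le fun _ => le_rfl

/-- `F`-progressive measurability of a real process. -/
def IsProgressive {d : ℕ} (Y : I → PathSpace d → ℝ) : Prop :=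
  IsStronglyProgressive (canonicalFiltration d) Y

/-- `F`-progressive measurability of an `ℝ^d`-valued process. -/
def IsProgressiveVec {d : ℕ} (H : I → PathSpace d → Fin d → ℝ) : Prop :=
  IsStronglyProgressive (canonicalFiltration d) H

/-- `a` is (a progressively measurable version of) the density `d⟨B⟩_t/dt` under `P`:
`⟨B⟩_t = ∫_0^t a_s ds` is the absolutely continuous, adapted, matrix-valued process, null at `0`,
that makes `B ⊗ B - ⟨B⟩` a martingale. Such an `a` is unique `dt × P`-almost everywhere. -/
structure IsQuadVarDensity {d : ℕ} (P : Measure (PathSpace d))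
    (a : I → PathSpace d → Matrix (Fin d) (Fin d) ℝ) : Prop where
  progressive : ∀ i j, IsProgressive fun t ω => a t ω i j
  integrable : ∀ᵐ ω ∂P, ∀ i j, Integrable (fun t => a t ω i j) (volume : Measure I)
  martingale : ∀ i j, Martingale
    (fun t ω => B t ω i * B t ω j - ∫ s in Set.Iic t, a s ω i j) (canonicalFiltration d) P

open Classical in
/-- The density `d⟨B⟩_t/dt` of the quadratic variation of the canonical process under `P`
(zero if there is none). -/
def quadVarDensity {d : ℕ} (P : Measure (PathSpace d)) :
    I → PathSpace d → Matrix (Fin d) (Fin d) ℝ :=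
  if h : ∃ a, IsQuadVarDensity P a then h.choose else 0

/-- `A ∨ c I_d = ∑ k, (λ_k ∨ c) ν_k ⊗ ν_k`, with `λ_k`, `ν_k` the eigenvalues and the orthonormal
eigenvectors of the symmetric matrix `A`. -/
def maxScalar {d : ℕ} {A : Matrix (Fin d) (Fin d) ℝ} (hA : A.IsHermitian) (c : ℝ) :
    Matrix (Fin d) (Fin d) ℝ :=
  ∑ k, max (hA.eigenvalues k) c •
    Matrix.vecMulVec (hA.eigenvectorBasis k).ofLp (hA.eigenvectorBasis k).ofLp

/-- The bounds `0 ≤ a_low ≤ a_up`, `a_up > 0`, on the volatility. -/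
structure VolBounds (d : ℕ) where
  low : Matrix (Fin d) (Fin d) ℝ
  up : Matrix (Fin d) (Fin d) ℝ
  low_nonneg : low.PosSemidef
  up_pos : up.PosDef
  low_le_up : (up - low).PosSemidef

/-- The set `𝒫` of probability measures under which `B` is a martingale with an absolutely
continuous quadratic variation whose density lies between `c I_d ∨ a_low` and `a_up`, for
some `c > 0` that may depend on the measure. -/
def measureClass {d : ℕ} (a : VolBounds d) : Set (Measure (PathSpace d)) :=
  {P | IsProbabilityMeasure P ∧ Martingale B (canonicalFiltration d) P ∧
    IsQuadVarDensity P (quadVarDensity P) ∧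
    ∃ c : ℝ, 0 < c ∧ ∀ᵐ ω ∂P, ∀ᵐ t : I,
      (quadVarDensity P t ω - maxScalar a.low_nonneg.isHermitian c).PosSemidef ∧
      (a.up - quadVarDensity P t ω).PosSemidef}

/-- The energy `∫_0^1 d⟨B⟩_t H_t · H_t` along a path, with `⟨B⟩` taken under `P`. -/
def energy {d : ℕ} (P : Measure (PathSpace d)) (H : I → PathSpace d → Fin d → ℝ)
    (ω : PathSpace d) : ℝ≥0∞ :=
  ∫⁻ t : I, ENNReal.ofReal ((quadVarDensity P t ω *ᵥ H t ω) ⬝ᵥ H t ω)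

/-- `‖H‖_{ℍ^p_𝒫} = (sup_{P ∈ 𝒫} E^P[(∫_0^1 d⟨B⟩_t H_t · H_t)^{p/2}])^{1/p}`. -/
def hNorm {d : ℕ} (a : VolBounds d) (p : ℝ) (H : I → PathSpace d → Fin d → ℝ) : ℝ≥0∞ :=
  (⨆ P ∈ measureClass a, ∫⁻ ω, energy P H ω ^ (p / 2) ∂P) ^ (1 / p)

/-- `‖Y‖_{𝕊^p_𝒫} = (sup_{P ∈ 𝒫} E^P[ess sup_t |Y_t|^p])^{1/p}`, for a family `Y = (Y^P)_P` of
processes, each considered under its own measure. -/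
def sNormFam {d : ℕ} (a : VolBounds d) (p : ℝ)
    (Y : Measure (PathSpace d) → I → PathSpace d → ℝ) : ℝ≥0∞ :=
  (⨆ P ∈ measureClass a, ∫⁻ ω, essSup (fun t : I => ‖Y P t ω‖ₑ ^ p) volume ∂P) ^ (1 / p)

/-- `‖Y‖_{𝕊^p_𝒫}` for one process `Y`. -/
def sNorm {d : ℕ} (a : VolBounds d) (p : ℝ) (Y : I → PathSpace d → ℝ) : ℝ≥0∞ :=
  sNormFam a p fun _ => Y

/-- `H ∈ ℍ^p_𝒫`. -/
structure MemH {d : ℕ} (a : VolBounds d) (p : ℝ) (H : I → PathSpace d → Fin d → ℝ) : Prop where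
  progressive : IsProgressiveVec H
  norm_lt_top : hNorm a p H < ∞

/-- `Y ∈ 𝕊^p_𝒫`. -/
structure MemS {d : ℕ} (a : VolBounds d) (p : ℝ) (Y : I → PathSpace d → ℝ) : Prop where
  progressive : IsProgressive Y
  continuous : ∀ P ∈ measureClass a, ∀ᵐ ω ∂P, Continuous fun t => Y t ω
  norm_lt_top : sNorm a p Y < ∞

/-- `K ∈ 𝕀^p_𝒫`. -/
structure MemI {d : ℕ} (a : VolBounds d) (p : ℝ) (K : I → PathSpace d → ℝ) : Prop
    extends MemS a p K where
  monotone : ∀ P ∈ measureClass a, ∀ᵐ ω ∂P, Monotone fun t => K t ω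
  zero : ∀ P ∈ measureClass a, ∀ᵐ ω ∂P, K 0 ω = 0

/-- A simple integrand `∑_{i < n} ξ_i 1_{[t_i, t_{i+1})}` with `ξ_i` bounded and
`F_{t_i}`-measurable. -/
structure SimpleIntegrand (d : ℕ) where
  n : ℕ
  time : ℕ → I
  time_mono : Monotone time
  coeff : ℕ → PathSpace d → Fin d → ℝ
  coeff_meas : ∀ i, StronglyMeasurable[canonicalFiltration d (time i)] (coeff i)
  coeff_bdd : ∃ R : ℝ, ∀ i ω k, |coeff i ω k| ≤ R

/-- The simple integrand as a process. -/
def SimpleIntegrand.value {d : ℕ} (S : SimpleIntegrand d) (t : I) (ω : PathSpace d) :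
    Fin d → ℝ :=
  ∑ i ∈ Finset.range S.n,
    (Set.Ico (S.time i) (S.time (i + 1))).indicator (fun _ => S.coeff i ω) t

/-- Its pathwise stochastic integral `∑_{i < n} ξ_i · (B_{t ∧ t_{i+1}} - B_{t ∧ t_i})`. -/
def SimpleIntegrand.integral {d : ℕ} (S : SimpleIntegrand d) (t : I) (ω : PathSpace d) : ℝ :=
  ∑ i ∈ Finset.range S.n,
    S.coeff i ω ⬝ᵥ (B (min t (S.time (i + 1))) ω - B (min t (S.time i)) ω)

/-- `X` is (a progressively measurable, almost surely continuous version of) the Itô integral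
`∫_0^· H_s dB_s` under `P`: the limit, in `L²(P)` uniformly in time, of the integrals of simple
integrands that converge to `H` in the energy norm `E^P[∫_0^1 d⟨B⟩_t H_t · H_t]`. -/
structure IsItoIntegral {d : ℕ} (P : Measure (PathSpace d)) (H : I → PathSpace d → Fin d → ℝ)
    (X : I → PathSpace d → ℝ) : Prop where
  progressive : IsProgressive X
  continuous : ∀ᵐ ω ∂P, Continuous fun t => X t ω
  approx : ∃ S : ℕ → SimpleIntegrand d,
    Tendsto (fun n => ∫⁻ ω, energy P ((S n).value - H) ω ∂P) atTop (𝓝 0) ∧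
    Tendsto (fun n => ∫⁻ ω, (⨆ t : I, ‖(S n).integral t ω - X t ω‖ₑ) ^ 2 ∂P) atTop (𝓝 0)

/-- `M_t = m + ∫_0^t H_s dB_s - K_t` for all `t ∈ [0,1]`, `P`-a.s. for every `P ∈ 𝒫`. For a general
`H ∈ ℍ²_𝒫` the stochastic integral is defined under each `P` separately, so `M = (M^P)_P` is a
family; a process `M` that is defined for all `P` at once is the constant family.
The initial value is a real number since `F_0` is trivial. -/
def IsDecomposition {d : ℕ} (a : VolBounds d) (M : Measure (PathSpace d) → I → PathSpace d → ℝ)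
    (m : ℝ) (H : I → PathSpace d → Fin d → ℝ) (K : I → PathSpace d → ℝ) : Prop :=
  ∀ P ∈ measureClass a, ∃ X, IsItoIntegral P H X ∧
    ∀ᵐ ω ∂P, ∀ t, M P t ω = m + X t ω - K t ω

end GMart

end

/-!
Under a fixed `P ∈ 𝒫`, let `Y = M + K = M₀ + ∫ H dB`, a square-integrable martingale, and let `S` be
the `𝕊²` norm of `M` under `P`. The Itô isometry gives `‖H‖ ≤ ‖Y₁‖`, and Doob's inequality gives
`‖K‖ ≤ S + 2 ‖Y₁‖`, so it remains to bound `‖Y₁‖`. Summation by parts in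
`Y₁² = M₁² + 2 Y₁ K₁ - K₁²` along a grid leaves a martingale transform of mean zero, a Riemann sum
of `∫ M dK`, and the quadratic variation of `K`, which vanishes as the mesh tends to zero. Hence
`‖Y₁‖² ≤ S² + 2 S ‖K₁‖`, where for a difference `K = K¹ - K²` the variable `K₁` on the right is
replaced by the bound `K¹₁ + K²₁` for the total variation. For one process `‖K₁‖ ≤ S + 2 ‖Y₁‖`
makes this a quadratic inequality for `‖Y₁‖` with solution `‖Y₁‖ ≤ 5 S`. No constant depends on `P`
or on the dimension.
-/

noncomputable section

namespace GMart

section Martingale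

variable {Ω ι : Type*} {m0 : MeasurableSpace Ω} {μ : Measure Ω}

theorem condExp_mul_sub [IsFiniteMeasure μ] [Preorder ι] {ℱ : Filtration ι m0} {M : ι → Ω → ℝ}
    (hM : Martingale M ℱ μ) {u s t : ι} (hus : u ≤ s) (hst : s ≤ t) {ξ : Ω → ℝ}
    (hξ : StronglyMeasurable[ℱ u] ξ) (hint : Integrable (fun ω => ξ ω * (M t ω - M u ω)) μ) :
    μ[fun ω => ξ ω * (M t ω - M u ω) | ℱ s] =ᵐ[μ] fun ω => ξ ω * (M s ω - M u ω) := by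
  have hMtu := (hM.integrable t).sub (hM.integrable u)
  have hpull : μ[ξ * (M t - M u) | ℱ s] =ᵐ[μ] ξ * μ[M t - M u | ℱ s] :=
    condExp_mul_of_stronglyMeasurable_left (hξ.mono (ℱ.mono hus)) hint hMtu
  have hsub : μ[M t - M u | ℱ s] =ᵐ[μ] M s - M u := by
    refine (condExp_sub (hM.integrable t) (hM.integrable u) _).trans
      ((hM.condExp_ae_eq hst).sub (EventuallyEq.of_eq ?_))
    exact condExp_of_stronglyMeasurable (ℱ.le s) ((hM.stronglyAdapted u).mono (ℱ.mono hus))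
      (hM.integrable u)
  filter_upwards [hpull, hsub] with ω h h'
  exact h.trans (by simp [h'])

theorem integral_mul_sub_eq_zero [IsFiniteMeasure μ] [Preorder ι] {ℱ : Filtration ι m0}
    {M : ι → Ω → ℝ} (hM : Martingale M ℱ μ) {s t : ι} (hst : s ≤ t) {ξ : Ω → ℝ}
    (hξ : StronglyMeasurable[ℱ s] ξ) (hint : Integrable (fun ω => ξ ω * (M t ω - M s ω)) μ) :
    ∫ ω, ξ ω * (M t ω - M s ω) ∂μ = 0 := by
  rw [← integral_condExp (ℱ.le s), integral_congr_ae (condExp_mul_sub hM le_rfl hst hξ hint)]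
  simp

theorem martingale_of_tendsto_eLpNorm [Preorder ι] {ℱ : Filtration ι m0}
    {M : ι → Ω → ℝ} {Mn : ℕ → ι → Ω → ℝ} {p : ℝ≥0∞} (hp : 1 ≤ p)
    (hMn : ∀ n, Martingale (Mn n) ℱ μ) (hadp : StronglyAdapted ℱ M)
    (hint : ∀ t, Integrable (M t) μ)
    (hlim : ∀ t, Tendsto (fun n => eLpNorm (Mn n t - M t) p μ) atTop (𝓝 0)) :
    Martingale M ℱ μ := by
  refine ⟨hadp, fun s t hst => ?_⟩
  have hbound (n : ℕ) : eLpNorm (μ[M t | ℱ s] - M s) p μ ≤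
      eLpNorm (Mn n s - M s) p μ + eLpNorm (Mn n t - M t) p μ := by
    have hsplit : μ[M t | ℱ s] - M s =ᵐ[μ] (Mn n s - M s) - μ[Mn n t - M t | ℱ s] := by
      filter_upwards [condExp_sub ((hMn n).integrable t) (hint t) (ℱ s),
        (hMn n).condExp_ae_eq hst] with ω h h'
      simp only [Pi.sub_apply, h, h']
      ring
    rw [eLpNorm_congr_ae hsplit]
    refine (eLpNorm_sub_le (((hMn n).integrable s).sub (hint s)).1
      integrable_condExp.1 hp).trans ?_
    gcongr
    exact eLpNorm_condExp_le_eLpNorm _ hp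
  have hzero : eLpNorm (μ[M t | ℱ s] - M s) p μ = 0 := by
    have hsum := (hlim s).add (hlim t)
    rw [add_zero] at hsum
    exact le_antisymm (ge_of_tendsto' hsum hbound) zero_le
  rw [eLpNorm_eq_zero_iff (integrable_condExp.sub (hint s)).1 (by positivity)] at hzero
  filter_upwards [hzero] with ω hω using sub_eq_zero.mp hω

/-- A square-integrable martingale. -/
structure IsL2Martingale [Preorder ι] (M : ι → Ω → ℝ) (ℱ : Filtration ι m0) (μ : Measure Ω) :
    Prop where
  martingale : Martingale M ℱ μ
  memLp : ∀ t, MemLp (M t) 2 μ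

theorem memLp_mul_of_abs_le {ξ f : Ω → ℝ} {R : ℝ} {p : ℝ≥0∞} (hf : MemLp f p μ)
    (hξ : AEStronglyMeasurable ξ μ) (hR : ∀ ω, |ξ ω| ≤ R) : MemLp (fun ω => ξ ω * f ω) p μ :=
  hf.mul (memLp_top_of_bound hξ R (ae_of_all _ hR))

namespace IsL2Martingale

variable [Preorder ι] {ℱ : Filtration ι m0} {M N : ι → Ω → ℝ}

protected theorem const [IsFiniteMeasure μ] (c : ℝ) :
    IsL2Martingale (fun _ _ => c : ι → Ω → ℝ) ℱ μ :=
  ⟨martingale_const ℱ μ c, fun _ => memLp_const c⟩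

theorem add (hM : IsL2Martingale M ℱ μ) (hN : IsL2Martingale N ℱ μ) :
    IsL2Martingale (fun t ω => M t ω + N t ω) ℱ μ :=
  ⟨hM.martingale.add hN.martingale, fun t => (hM.memLp t).add (hN.memLp t)⟩

theorem sub (hM : IsL2Martingale M ℱ μ) (hN : IsL2Martingale N ℱ μ) :
    IsL2Martingale (fun t ω => M t ω - N t ω) ℱ μ :=
  ⟨hM.martingale.sub hN.martingale, fun t => (hM.memLp t).sub (hN.memLp t)⟩

theorem sum [IsFiniteMeasure μ] {κ : Type*} {s : Finset κ} {F : κ → ι → Ω → ℝ}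
    (hF : ∀ i ∈ s, IsL2Martingale (F i) ℱ μ) :
    IsL2Martingale (fun t ω => ∑ i ∈ s, F i t ω) ℱ μ := by
  classical
  induction s using Finset.induction_on with
  | empty => simpa using IsL2Martingale.const 0
  | insert i s hi ih =>
    simp only [Finset.sum_insert hi]
    exact (hF i (s.mem_insert_self i)).add (ih fun j hj => hF j (Finset.mem_insert_of_mem hj))

theorem of_tendsto [IsFiniteMeasure μ] {Mn : ℕ → ι → Ω → ℝ} (hMn : ∀ n, IsL2Martingale (Mn n) ℱ μ)
    (hadp : StronglyAdapted ℱ M)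
    (hlim : ∀ t, Tendsto (fun n => eLpNorm (Mn n t - M t) 2 μ) atTop (𝓝 0)) :
    IsL2Martingale M ℱ μ := by
  have hmeas (t : ι) : AEStronglyMeasurable (M t) μ :=
    ((hadp t).mono (ℱ.le t)).aestronglyMeasurable
  have hmem (t : ι) : MemLp (M t) 2 μ := by
    obtain ⟨n, hn⟩ := ((hlim t).eventually (gt_mem_nhds zero_lt_one)).exists
    have hdiff : MemLp (Mn n t - M t) 2 μ :=
      ⟨((hMn n).memLp t).1.sub (hmeas t), hn.trans ENNReal.one_lt_top⟩
    simpa using ((hMn n).memLp t).sub hdiff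
  exact ⟨martingale_of_tendsto_eLpNorm one_le_two (fun n => (hMn n).martingale) hadp
    (fun t => (hmem t).integrable one_le_two) hlim, hmem⟩

end IsL2Martingale

section Elementary

variable [LinearOrder ι] {ℱ : Filtration ι m0} {M N A : ι → Ω → ℝ} {u : ι} {ξ : Ω → ℝ}

/-- The stochastic integral of the elementary integrand `ξ 1_{(u, ∞)}` against `M`. -/
def elemIntegral (u : ι) (ξ : Ω → ℝ) (M : ι → Ω → ℝ) (t : ι) (ω : Ω) : ℝ :=
  ξ ω * (M t ω - M (min t u) ω)

theorem elemIntegral_of_le {t : ι} (h : t ≤ u) (ξ : Ω → ℝ) (M : ι → Ω → ℝ) :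
    elemIntegral u ξ M t = 0 := by
  ext ω
  simp [elemIntegral, h]

theorem elemIntegral_of_ge {t : ι} (h : u ≤ t) (ξ : Ω → ℝ) (M : ι → Ω → ℝ) :
    elemIntegral u ξ M t = fun ω => ξ ω * (M t ω - M u ω) := by
  ext ω
  simp [elemIntegral, h]

theorem martingale_elemIntegral [IsFiniteMeasure μ] (hM : Martingale M ℱ μ)
    (hξ : StronglyMeasurable[ℱ u] ξ) (hint : ∀ t, Integrable (elemIntegral u ξ M t) μ) :
    Martingale (elemIntegral u ξ M) ℱ μ := by
  have condExp_of_ge {s t : ι} (hus : u ≤ s) (hst : s ≤ t) :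
      μ[elemIntegral u ξ M t | ℱ s] =ᵐ[μ] elemIntegral u ξ M s := by
    rw [elemIntegral_of_ge hus, elemIntegral_of_ge (hus.trans hst)]
    exact condExp_mul_sub hM hus hst hξ (elemIntegral_of_ge (hus.trans hst) ξ M ▸ hint t)
  refine ⟨fun t => ?_, fun s t hst => ?_⟩
  · rcases le_total t u with htu | hut
    · simpa only [elemIntegral_of_le htu] using stronglyMeasurable_zero
    · rw [elemIntegral_of_ge hut]
      exact (hξ.mono (ℱ.mono hut)).mul
        ((hM.stronglyAdapted t).sub ((hM.stronglyAdapted u).mono (ℱ.mono hut)))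
  · rcases le_total u s with hus | hsu
    · exact condExp_of_ge hus hst
    rw [elemIntegral_of_le hsu]
    rcases le_total t u with htu | hut
    · simp [elemIntegral_of_le htu]
    · refine (condExp_condExp_of_le (ℱ.mono hsu) (ℱ.le u)).symm.trans ?_
      refine (condExp_congr_ae (condExp_of_ge le_rfl hut)).trans ?_
      simp [elemIntegral_of_le]

theorem IsL2Martingale.elemIntegral [IsFiniteMeasure μ] (hM : IsL2Martingale M ℱ μ) {R : ℝ}
    (hξ : StronglyMeasurable[ℱ u] ξ) (hR : ∀ ω, |ξ ω| ≤ R) :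
    IsL2Martingale (elemIntegral u ξ M) ℱ μ := by
  have hmem (t : ι) : MemLp (GMart.elemIntegral u ξ M t) 2 μ :=
    memLp_mul_of_abs_le ((hM.memLp t).sub (hM.memLp _))
      (hξ.mono (ℱ.le u)).aestronglyMeasurable hR
  exact ⟨martingale_elemIntegral hM.martingale hξ fun t => (hmem t).integrable one_le_two, hmem⟩

/-- `A` is a version of the quadratic covariation `⟨M, N⟩`, in the weak sense that `M N - A` is a
martingale; `A` is not required to be predictable or of finite variation. -/
def IsBracket (ℱ : Filtration ι m0) (μ : Measure Ω) (M N A : ι → Ω → ℝ) : Prop :=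
  Martingale (fun t ω => M t ω * N t ω - A t ω) ℱ μ

namespace IsBracket

theorem symm (h : IsBracket ℱ μ M N A) : IsBracket ℱ μ N M A := by
  simpa only [IsBracket, mul_comm] using h

theorem sub {M' A' : ι → Ω → ℝ} (h : IsBracket ℱ μ M N A) (h' : IsBracket ℱ μ M' N A') :
    IsBracket ℱ μ (fun t ω => M t ω - M' t ω) N (fun t ω => A t ω - A' t ω) := by
  have := Martingale.sub h h'
  refine (congrArg (Martingale · ℱ μ) ?_).mp this
  ext t ω
  simp only [Pi.sub_apply]
  ring

theorem sum {κ : Type*} {s : Finset κ} {F G : κ → ι → Ω → ℝ}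
    (h : ∀ i ∈ s, IsBracket ℱ μ (F i) N (G i)) :
    IsBracket ℱ μ (fun t ω => ∑ i ∈ s, F i t ω) N (fun t ω => ∑ i ∈ s, G i t ω) := by
  classical
  induction s using Finset.induction_on with
  | empty =>
    refine (congrArg (Martingale · ℱ μ) ?_).mp (martingale_zero ℝ ℱ μ)
    ext t ω
    simp
  | insert i s hi ih =>
    have := Martingale.add (h i (s.mem_insert_self i))
      (ih fun j hj => h j (Finset.mem_insert_of_mem hj))
    refine (congrArg (Martingale · ℱ μ) ?_).mp this
    ext t ω
    simp only [Pi.add_apply, Finset.sum_insert hi]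
    ring

theorem integrable (h : IsBracket ℱ μ M N A) (hM : IsL2Martingale M ℱ μ)
    (hN : IsL2Martingale N ℱ μ) (t : ι) : Integrable (A t) μ := by
  refine (((hM.memLp t).integrable_mul (hN.memLp t)).sub (Martingale.integrable h t)).congr ?_
  exact ae_of_all _ fun ω => sub_sub_cancel _ _

theorem integral_mul_eq [IsFiniteMeasure μ] (h : IsBracket ℱ μ M N A)
    (hM : IsL2Martingale M ℱ μ) (hN : IsL2Martingale N ℱ μ) {s t : ι} (hst : s ≤ t)
    (hs : ∀ ω, M s ω * N s ω = A s ω) : ∫ ω, M t ω * N t ω ∂μ = ∫ ω, A t ω ∂μ := by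
  have hMN : Integrable (fun ω => M t ω * N t ω) μ := (hM.memLp t).integrable_mul (hN.memLp t)
  rw [← sub_eq_zero, ← integral_sub hMN (h.integrable hM hN t), ← integral_condExp (ℱ.le s),
    integral_congr_ae (Martingale.condExp_ae_eq h hst)]
  simp [hs]

/-- With `Z = M N - A`, the process `(∫ ξ dM) N - ∫ ξ dA` is `∫ ξ dZ - ∫ ξ M_u dN`. -/
theorem elemIntegral [IsFiniteMeasure μ] (h : IsBracket ℱ μ M N A) (hM : IsL2Martingale M ℱ μ)
    (hN : IsL2Martingale N ℱ μ) {R : ℝ} (hξ : StronglyMeasurable[ℱ u] ξ)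
    (hR : ∀ ω, |ξ ω| ≤ R) :
    IsBracket ℱ μ (elemIntegral u ξ M) N (elemIntegral u ξ A) := by
  have hξ' : AEStronglyMeasurable ξ μ := (hξ.mono (ℱ.le u)).aestronglyMeasurable
  have hZ : Martingale (GMart.elemIntegral u ξ fun t ω => M t ω * N t ω - A t ω) ℱ μ :=
    martingale_elemIntegral h hξ fun t => memLp_one_iff_integrable.mp
      (memLp_mul_of_abs_le (memLp_one_iff_integrable.mpr
        ((Martingale.integrable h t).sub (Martingale.integrable h _))) hξ' hR)
  have hMN : Martingale (GMart.elemIntegral u (fun ω => ξ ω * M u ω) N) ℱ μ :=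
    martingale_elemIntegral hN.martingale (hξ.mul (hM.martingale.stronglyAdapted u)) fun t =>
      (memLp_mul_of_abs_le (hM.memLp u) hξ' hR).integrable_mul ((hN.memLp t).sub (hN.memLp _))
  refine (congrArg (Martingale · ℱ μ) ?_).mp (hZ.sub hMN)
  ext t ω
  simp only [Pi.sub_apply, GMart.elemIntegral]
  rcases le_total t u with htu | hut
  · simp [htu]
  · simp only [min_eq_right hut]
    ring

end IsBracket

end Elementary

end Martingale

section Doob

theorem sq_partialSups_add_le (S : ℕ → ℝ) (n : ℕ) :
    partialSups S n ^ 2 + 4 * ∑ i ∈ Finset.range n, partialSups S i * (S (i + 1) - S i) ≤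
      4 * S n ^ 2 := by
  have hsum : partialSups S n ^ 2 + 2 * ∑ i ∈ Finset.range n, partialSups S i * (S (i + 1) - S i) ≤
      2 * (partialSups S n * S n) := by
    induction n with
    | zero => simp only [partialSups_zero, Finset.range_zero, Finset.sum_empty]; nlinarith
    | succ n ih =>
      rw [Finset.sum_range_succ, partialSups_add_one]
      rcases le_total (partialSups S n) (S (n + 1)) with h | h
      · rw [sup_eq_right.2 h]
        nlinarith [sq_nonneg (S (n + 1) - partialSups S n)]
      · rw [sup_eq_left.2 h]
        nlinarith
  nlinarith [sq_nonneg (partialSups S n - 2 * S n)]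

variable {Ω ι : Type*} {m0 : MeasurableSpace Ω} {μ : Measure Ω}

theorem ofReal_integral_sq {f : Ω → ℝ} (hf : MemLp f 2 μ) :
    ENNReal.ofReal (∫ ω, f ω ^ 2 ∂μ) = eLpNorm f 2 μ ^ 2 := by
  rw [hf.eLpNorm_eq_integral_rpow_norm two_ne_zero ENNReal.ofNat_ne_top, ← ENNReal.ofReal_pow
    (by positivity), ← Real.rpow_natCast, ← Real.rpow_mul (by positivity)]
  simp

theorem integral_mul_sub_nonneg [IsFiniteMeasure μ] [Preorder ι] {ℱ : Filtration ι m0}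
    {X : ι → Ω → ℝ} (hX : Submartingale X ℱ μ) {s t : ι} (hst : s ≤ t) {ξ : Ω → ℝ}
    (hξ : StronglyMeasurable[ℱ s] ξ) (hξ0 : 0 ≤ ξ)
    (hint : Integrable (fun ω => ξ ω * (X t ω - X s ω)) μ) :
    0 ≤ ∫ ω, ξ ω * (X t ω - X s ω) ∂μ := by
  rw [← integral_condExp (ℱ.le s)]
  refine integral_nonneg_of_ae ?_
  filter_upwards [condExp_mul_of_stronglyMeasurable_left hξ hint
    ((hX.integrable t).sub (hX.integrable s)), hX.condExp_sub_nonneg hst] with ω hpull hnonneg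
  exact (mul_nonneg (hξ0 ω) hnonneg).trans_eq hpull.symm

theorem stronglyMeasurable_partialSups {X : ℕ → Ω → ℝ} {n : ℕ}
    (hX : ∀ i ≤ n, StronglyMeasurable (X i)) :
    StronglyMeasurable fun ω => partialSups (fun i => X i ω) n := by
  induction n with
  | zero => simpa only [partialSups_zero] using hX 0 le_rfl
  | succ n ih =>
    simp only [partialSups_add_one]
    exact (ih fun i hi => hX i (hi.trans n.le_succ)).sup (hX _ le_rfl)

theorem memLp_partialSups {X : ℕ → Ω → ℝ} {p : ℝ≥0∞} (hX : ∀ i, MemLp (X i) p μ) (n : ℕ) :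
    MemLp (fun ω => partialSups (fun i => X i ω) n) p μ := by
  induction n with
  | zero => simpa only [partialSups_zero] using hX 0
  | succ n ih =>
    simp only [partialSups_add_one]
    exact ih.sup (hX _)

theorem eLpNorm_partialSups_le [IsFiniteMeasure μ] [Preorder ι] {ℱ : Filtration ι m0}
    {X : ι → Ω → ℝ} (hX : Submartingale X ℱ μ) (hX0 : ∀ t, 0 ≤ X t) (hX2 : ∀ t, MemLp (X t) 2 μ)
    {τ : ℕ → ι} (hτ : Monotone τ) (n : ℕ) :
    eLpNorm (fun ω => partialSups (fun i => X (τ i) ω) n) 2 μ ≤ 2 * eLpNorm (X (τ n)) 2 μ := by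
  set S : ℕ → Ω → ℝ := fun i ω => partialSups (fun j => X (τ j) ω) i
  have hS2 (i : ℕ) : MemLp (S i) 2 μ := memLp_partialSups (fun j => hX2 (τ j)) i
  have hS0 (i : ℕ) : 0 ≤ S i := fun ω =>
    (hX0 _ ω).trans (le_partialSups_of_le (fun j => X (τ j) ω) i.zero_le)
  have hSm (i : ℕ) : StronglyMeasurable[ℱ (τ i)] (S i) :=
    stronglyMeasurable_partialSups fun j hj => (hX.stronglyAdapted _).mono (ℱ.mono (hτ hj))
  have hterm (i : ℕ) : Integrable (fun ω => S i ω * (X (τ (i + 1)) ω - X (τ i) ω)) μ :=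
    (hS2 i).integrable_mul ((hX2 _).sub (hX2 _))
  have hnonneg : 0 ≤ ∑ i ∈ Finset.range n, ∫ ω, S i ω * (X (τ (i + 1)) ω - X (τ i) ω) ∂μ :=
    Finset.sum_nonneg fun i _ =>
      integral_mul_sub_nonneg hX (hτ i.le_succ) (hSm i) (hS0 i) (hterm i)
  have hsq : ∫ ω, S n ω ^ 2 ∂μ ≤ 2 ^ 2 * ∫ ω, X (τ n) ω ^ 2 ∂μ := by
    have hsum := integrable_finsetSum (Finset.range n) fun i _ => hterm i
    have hmono := integral_mono ((hS2 n).integrable_sq.add (hsum.const_mul 4))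
      ((hX2 (τ n)).integrable_sq.const_mul 4)
      fun ω => sq_partialSups_add_le (fun i => X (τ i) ω) n
    simp only [Pi.add_apply] at hmono
    rw [integral_add (hS2 n).integrable_sq (hsum.const_mul 4), integral_const_mul,
      integral_const_mul, integral_finsetSum _ fun i _ => hterm i] at hmono
    linarith
  have hofReal := ENNReal.ofReal_le_ofReal hsq
  rw [ENNReal.ofReal_mul (by norm_num), ofReal_integral_sq (hS2 n),
    ofReal_integral_sq (hX2 (τ n)), ENNReal.ofReal_pow (by norm_num), ← mul_pow,
    ENNReal.pow_le_pow_left_iff two_ne_zero, ENNReal.ofReal_ofNat] at hofReal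
  exact hofReal

end Doob

section PathSupremum

/-- The points `i / (n + 1)` of the unit interval. -/
def grid (n i : ℕ) : I := Set.Icc.addNSMul zero_le_one (1 / ((n : ℝ) + 1)) i

theorem grid_mono (n : ℕ) : Monotone (grid n) :=
  Set.Icc.monotone_addNSMul _ (by positivity)

theorem grid_zero (n : ℕ) : grid n 0 = 0 :=
  Subtype.ext (Set.Icc.addNSMul_zero zero_le_one)

theorem grid_last (n : ℕ) : grid n (n + 1) = 1 := by
  have h : (0 : ℝ) + (n + 1) • (1 / ((n : ℝ) + 1)) = 1 := by
    rw [nsmul_eq_mul]; push_cast; field_simp; ring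
  rw [grid, Set.Icc.addNSMul, h, Set.projIcc_right]
  rfl

theorem dist_grid_succ_le (n i : ℕ) : dist (grid n (i + 1)) (grid n i) ≤ 1 / ((n : ℝ) + 1) :=
  Set.Icc.abs_sub_addNSMul_le zero_le_one (by positivity) i ⟨grid_mono n i.le_succ, le_rfl⟩

theorem exists_tendsto_grid (t : I) :
    ∃ i : ℕ → ℕ, (∀ n, i n ≤ n + 1) ∧ Tendsto (fun n => grid n (i n)) atTop (𝓝 t) := by
  refine ⟨fun n => ⌊(t : ℝ) * ((n : ℝ) + 1)⌋₊, fun n => ?_, ?_⟩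
  · refine Nat.floor_le_of_le ?_
    push_cast
    exact mul_le_of_le_one_left (by positivity) t.2.2
  · have hfloor := (tendsto_nat_floor_mul_div_atTop (R := ℝ) t.2.1).comp
      (tendsto_atTop_add_const_right atTop 1 (tendsto_natCast_atTop_atTop (R := ℝ)))
    have hproj := (continuous_projIcc (h := zero_le_one (α := ℝ))).continuousAt.tendsto.comp hfloor
    rw [Set.projIcc_val] at hproj
    refine hproj.congr fun n => ?_
    simp [grid, Set.Icc.addNSMul, div_eq_mul_inv]

variable {Ω : Type*} {m0 : MeasurableSpace Ω} {μ : Measure Ω} {f g : I → Ω → ℝ}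

/-- The supremum `sup_t |f_t|` over the whole time interval; it is the junk value `0` on
unbounded paths. -/
def supAbs (f : I → Ω → ℝ) (ω : Ω) : ℝ := ⨆ t, |f t ω|

theorem supAbs_nonneg (f : I → Ω → ℝ) (ω : Ω) : 0 ≤ supAbs f ω :=
  Real.iSup_nonneg fun _ => abs_nonneg _

theorem supAbs_le {ω : Ω} {r : ℝ} (h : ∀ t, |f t ω| ≤ r) : supAbs f ω ≤ r := ciSup_le h

theorem abs_le_supAbs {ω : Ω} (hf : Continuous fun t => f t ω) (t : I) : |f t ω| ≤ supAbs f ω :=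
  le_ciSup (isCompact_range hf.abs).bddAbove t

theorem exists_abs_eq_supAbs {ω : Ω} (hf : Continuous fun t => f t ω) :
    ∃ t, |f t ω| = supAbs f ω := by
  obtain ⟨t, ht⟩ := hf.abs.exists_forall_ge (by simp)
  exact ⟨t, le_antisymm (abs_le_supAbs hf t) (supAbs_le ht)⟩

theorem aestronglyMeasurable_supAbs (hm : ∀ t, AEStronglyMeasurable (f t) μ)
    (hc : ∀ᵐ ω ∂μ, Continuous fun t => f t ω) : AEStronglyMeasurable (supAbs f) μ := by
  obtain ⟨S, hS, hdense⟩ := TopologicalSpace.exists_countable_dense I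
  have : Countable S := hS
  have hmeas : AEMeasurable (fun ω => ⨆ t : S, |f t ω|) μ :=
    AEMeasurable.iSup fun t => (hm t).aemeasurable.abs
  refine hmeas.aestronglyMeasurable.congr ?_
  filter_upwards [hc] with ω hω
  exact hdense.ciSup' hω.abs

/-- The `𝕊²` norm of a process under a single measure. -/
def starNorm (μ : Measure Ω) (f : I → Ω → ℝ) : ℝ≥0∞ :=
  (∫⁻ ω, essSup (fun t : I => ‖f t ω‖ₑ ^ (2 : ℝ)) volume ∂μ) ^ (1 / 2 : ℝ)

theorem starNorm_congr (h : ∀ᵐ ω ∂μ, ∀ t, f t ω = g t ω) : starNorm μ f = starNorm μ g := by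
  rw [starNorm, starNorm]
  congr 1
  refine lintegral_congr_ae ?_
  filter_upwards [h] with ω hω
  simp only [hω]

instance isOpenPosMeasure_unitInterval : (volume : Measure I).IsOpenPosMeasure where
  open_pos U hU hne := by
    obtain ⟨u, v, huv, hsub⟩ := hU.exists_Ioo_subset hne
    refine fun h0 => huv.not_ge ?_
    simpa using measure_mono_null hsub h0

theorem essSup_eq_iSup_of_continuous {X : Type*} [TopologicalSpace X] [MeasurableSpace X]
    {ν : Measure X} [ν.IsOpenPosMeasure] {f : X → ℝ≥0∞} (hf : Continuous f) :
    essSup f ν = ⨆ x, f x := by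
  refine le_antisymm (essSup_le_of_ae_le _ (ae_of_all _ (le_iSup f))) (iSup_le fun x => ?_)
  by_contra! hlt
  have hnull : ν {y | essSup f ν < f y} = 0 := by
    simpa only [ae_iff, not_le] using ENNReal.ae_le_essSup f
  exact (isOpen_lt continuous_const hf).measure_ne_zero ν ⟨x, hlt⟩ hnull

theorem starNorm_eq_eLpNorm_supAbs (hc : ∀ᵐ ω ∂μ, Continuous fun t => f t ω) :
    starNorm μ f = eLpNorm (supAbs f) 2 μ := by
  rw [starNorm, eLpNorm_eq_lintegral_rpow_enorm_toReal two_ne_zero ENNReal.ofNat_ne_top]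
  congr 1
  refine lintegral_congr_ae ?_
  filter_upwards [hc] with ω hω
  obtain ⟨t, ht⟩ := exists_abs_eq_supAbs hω
  have hsq : Continuous fun t => ‖f t ω‖ₑ ^ (2 : ℝ) := ENNReal.continuous_rpow_const.comp hω.enorm
  rw [essSup_eq_iSup_of_continuous hsq, ENNReal.toReal_ofNat, ← ht, Real.enorm_abs]
  refine le_antisymm (iSup_le fun s => ?_) (le_iSup (fun s => ‖f s ω‖ₑ ^ (2 : ℝ)) t)
  rw [← Real.enorm_abs (f t ω), ht]
  gcongr
  exact enorm_le_iff_norm_le.2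
    (by simpa [abs_of_nonneg (supAbs_nonneg f ω)] using abs_le_supAbs hω s)

theorem tendsto_partialSups_grid {ω : Ω} (hf : Continuous fun t => f t ω) :
    Tendsto (fun n => partialSups (fun i => |f (grid n i) ω|) (n + 1)) atTop
      (𝓝 (supAbs f ω)) := by
  obtain ⟨t, ht⟩ := exists_abs_eq_supAbs hf
  obtain ⟨i, hi, hit⟩ := exists_tendsto_grid t
  have hlower : Tendsto (fun n => |f (grid n (i n)) ω|) atTop (𝓝 (supAbs f ω)) :=
    ht ▸ (hf.abs.tendsto t).comp hit
  exact tendsto_of_tendsto_of_tendsto_of_le_of_le hlower tendsto_const_nhds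
    (fun n => le_partialSups_of_le (fun i => |f (grid n i) ω|) (hi n))
    fun n => partialSups_le _ _ _ fun i _ => abs_le_supAbs hf _

theorem IsL2Martingale.starNorm_le [IsFiniteMeasure μ] {ℱ : Filtration I m0} {M : I → Ω → ℝ}
    (hM : IsL2Martingale M ℱ μ) (hc : ∀ᵐ ω ∂μ, Continuous fun t => M t ω) :
    starNorm μ M ≤ 2 * eLpNorm (M 1) 2 μ := by
  have hsub : Submartingale (fun t ω => |M t ω|) ℱ μ :=
    hM.martingale.submartingale.sup hM.martingale.neg.submartingale
  have habs (t : I) : MemLp (fun ω => |M t ω|) 2 μ := (hM.memLp t).abs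
  have hgrid (n : ℕ) :
      eLpNorm (fun ω => partialSups (fun i => |M (grid n i) ω|) (n + 1)) 2 μ ≤
        2 * eLpNorm (M 1) 2 μ := by
    have := eLpNorm_partialSups_le hsub (fun t ω => abs_nonneg _) habs (grid_mono n) (n + 1)
    simpa only [grid_last, ← Real.norm_eq_abs, eLpNorm_norm] using this
  rw [starNorm_eq_eLpNorm_supAbs hc]
  refine (Lp.eLpNorm_lim_le_liminf_eLpNorm
    (fun n => (memLp_partialSups (fun i => habs (grid n i)) (n + 1)).1) _ ?_).trans
    ((liminf_le_liminf (Eventually.of_forall hgrid)).trans_eq (liminf_const _))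
  filter_upwards [hc] with ω hω using tendsto_partialSups_grid hω

end PathSupremum

section Variation

/-- `k` is a continuous path of finite variation started at `0`, and `w` is a path started at `0`
whose increments dominate those of `k`; thus `w 1` bounds the total variation of `k`. -/
structure IsVariationBound (k w : I → ℝ) : Prop where
  continuous : Continuous k
  abs_sub_le : ∀ ⦃s t⦄, s ≤ t → |k t - k s| ≤ w t - w s
  zero : k 0 = 0
  bound_zero : w 0 = 0

/-- The sum of the squared increments of `k` along the `n`-th grid. -/
def gridVariation (n : ℕ) (k : I → ℝ) : ℝ :=
  ∑ i ∈ Finset.range (n + 1), (k (grid n (i + 1)) - k (grid n i)) ^ 2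

theorem gridVariation_nonneg (n : ℕ) (k : I → ℝ) : 0 ≤ gridVariation n k :=
  Finset.sum_nonneg fun _ _ => sq_nonneg _

theorem gridVariation_le_mul_sum {n : ℕ} {k : I → ℝ} {r : ℝ}
    (h : ∀ i ≤ n, |k (grid n (i + 1)) - k (grid n i)| ≤ r) :
    gridVariation n k ≤
      r * ∑ i ∈ Finset.range (n + 1), |k (grid n (i + 1)) - k (grid n i)| := by
  rw [gridVariation, Finset.mul_sum]
  refine Finset.sum_le_sum fun i hi => ?_
  rw [← sq_abs, sq]
  exact mul_le_mul_of_nonneg_right (h i (Finset.mem_range_succ_iff.1 hi)) (abs_nonneg _)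

theorem two_mul_sum_mul_sub (k : ℕ → ℝ) (n : ℕ) :
    2 * ∑ i ∈ Finset.range n, k (i + 1) * (k (i + 1) - k i) =
      k n ^ 2 - k 0 ^ 2 + ∑ i ∈ Finset.range n, (k (i + 1) - k i) ^ 2 := by
  rw [← Finset.sum_range_sub fun i => k i ^ 2, ← Finset.sum_add_distrib, Finset.mul_sum]
  exact Finset.sum_congr rfl fun i _ => by ring

namespace IsVariationBound

variable {k k' w w' : I → ℝ}

theorem of_monotone (hc : Continuous k) (hk : Monotone k) (h0 : k 0 = 0) :
    IsVariationBound k k :=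
  ⟨hc, fun _ _ hst => (abs_of_nonneg (sub_nonneg.2 (hk hst))).le, h0, h0⟩

theorem sub (h : IsVariationBound k w) (h' : IsVariationBound k' w') :
    IsVariationBound (fun t => k t - k' t) (fun t => w t + w' t) where
  continuous := h.continuous.sub h'.continuous
  abs_sub_le s t hst := by
    rw [sub_sub_sub_comm, add_sub_add_comm]
    exact (abs_sub _ _).trans (add_le_add (h.abs_sub_le hst) (h'.abs_sub_le hst))
  zero := by rw [h.zero, h'.zero, sub_zero]
  bound_zero := by rw [h.bound_zero, h'.bound_zero, add_zero]

theorem abs_le (h : IsVariationBound k w) (t : I) : |k t| ≤ w 1 := by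
  have h0 := h.abs_sub_le (unitInterval.nonneg' (t := t))
  have h1 := (abs_nonneg _).trans (h.abs_sub_le (unitInterval.le_one' (t := t)))
  rw [h.zero, sub_zero, h.bound_zero] at h0
  linarith

theorem bound_nonneg (h : IsVariationBound k w) : 0 ≤ w 1 := (abs_nonneg _).trans (h.abs_le 0)

theorem sum_abs_le (h : IsVariationBound k w) (n : ℕ) :
    ∑ i ∈ Finset.range (n + 1), |k (grid n (i + 1)) - k (grid n i)| ≤ w 1 := by
  refine (Finset.sum_le_sum fun i _ => h.abs_sub_le (grid_mono n i.le_succ)).trans_eq ?_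
  rw [Finset.sum_range_sub fun i => w (grid n i), grid_last, grid_zero, h.bound_zero, sub_zero]

theorem gridVariation_le (h : IsVariationBound k w) (n : ℕ) : gridVariation n k ≤ w 1 ^ 2 := by
  rw [sq]
  refine (gridVariation_le_mul_sum fun i hi => ?_).trans
    (mul_le_mul_of_nonneg_left (h.sum_abs_le n) h.bound_nonneg)
  exact (Finset.single_le_sum (fun j _ => abs_nonneg (k (grid n (j + 1)) - k (grid n j)))
    (Finset.mem_range_succ_iff.2 hi)).trans (h.sum_abs_le n)

theorem tendsto_gridVariation (h : IsVariationBound k w) :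
    Tendsto (fun n => gridVariation n k) atTop (𝓝 0) := by
  rw [Metric.tendsto_atTop]
  intro ε hε
  have hw := h.bound_nonneg
  obtain ⟨δ, hδ, hkδ⟩ := Metric.uniformContinuous_iff.1
    (CompactSpace.uniformContinuous_of_continuous h.continuous) (ε / (w 1 + 1)) (by positivity)
  obtain ⟨n₀, hn₀⟩ := exists_nat_one_div_lt hδ
  refine ⟨n₀, fun n hn => ?_⟩
  have hinc (i : ℕ) : |k (grid n (i + 1)) - k (grid n i)| ≤ ε / (w 1 + 1) :=
    (hkδ ((dist_grid_succ_le n i).trans_lt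
      ((one_div_le_one_div_of_le (by positivity) (by gcongr)).trans_lt hn₀))).le
  rw [Real.dist_eq, sub_zero, abs_of_nonneg (gridVariation_nonneg n k)]
  calc gridVariation n k
      ≤ ε / (w 1 + 1) * w 1 := (gridVariation_le_mul_sum fun i _ => hinc i).trans
        (mul_le_mul_of_nonneg_left (h.sum_abs_le n) (by positivity))
    _ < ε := by rw [div_mul_eq_mul_div, div_lt_iff₀ (by positivity)]; nlinarith

/-- Summation by parts in `y₁² = (y₁ - k₁)² + 2 y₁ k₁ - k₁²`. The last sum is centered when `y` is a
martingale and `k` is adapted. -/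
theorem sq_le (h : IsVariationBound k w) {y : I → ℝ} {z : ℝ} (hz : ∀ t, |y t - k t| ≤ z) (n : ℕ) :
    y 1 ^ 2 ≤ z ^ 2 + 2 * (z * w 1) + gridVariation n k +
      2 * ∑ i ∈ Finset.range (n + 1),
        (k (grid n (i + 1)) - k (grid n i)) * (y 1 - y (grid n (i + 1))) := by
  set τ := grid n
  have hτ₀ : τ 0 = 0 := grid_zero n
  have hτ₁ : τ (n + 1) = 1 := grid_last n
  have hk₁ : ∑ i ∈ Finset.range (n + 1), (k (τ (i + 1)) - k (τ i)) = k 1 := by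
    rw [Finset.sum_range_sub fun i => k (τ i), hτ₁, hτ₀, h.zero, sub_zero]
  have hsq : 2 * ∑ i ∈ Finset.range (n + 1), k (τ (i + 1)) * (k (τ (i + 1)) - k (τ i)) =
      k 1 ^ 2 + gridVariation n k := by
    rw [two_mul_sum_mul_sub fun i => k (τ i), hτ₁, hτ₀, h.zero, gridVariation]
    ring
  have hdiff : ∑ i ∈ Finset.range (n + 1),
      (y (τ (i + 1)) - k (τ (i + 1))) * (k (τ (i + 1)) - k (τ i)) ≤ z * w 1 := by
    refine le_trans ?_ (mul_le_mul_of_nonneg_left (h.sum_abs_le n) ((abs_nonneg _).trans (hz 0)))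
    rw [Finset.mul_sum]
    refine Finset.sum_le_sum fun i _ => (le_abs_self _).trans ?_
    rw [abs_mul]
    exact mul_le_mul_of_nonneg_right (hz _) (abs_nonneg _)
  have hparts : y 1 * k 1 =
      ∑ i ∈ Finset.range (n + 1), (k (τ (i + 1)) - k (τ i)) * (y 1 - y (τ (i + 1))) +
      ∑ i ∈ Finset.range (n + 1), (y (τ (i + 1)) - k (τ (i + 1))) * (k (τ (i + 1)) - k (τ i)) +
      ∑ i ∈ Finset.range (n + 1), k (τ (i + 1)) * (k (τ (i + 1)) - k (τ i)) := by
    rw [← hk₁, Finset.mul_sum, ← Finset.sum_add_distrib, ← Finset.sum_add_distrib]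
    exact Finset.sum_congr rfl fun i _ => by ring
  have hz₁ : (y 1 - k 1) ^ 2 ≤ z ^ 2 := sq_le_sq.2 ((hz 1).trans (le_abs_self z))
  linarith

end IsVariationBound

end Variation

section EnergyEstimate

variable {Ω : Type*} {m0 : MeasurableSpace Ω} {μ : Measure Ω} {ℱ : Filtration I m0}
  {f g Y K W : I → Ω → ℝ}

theorem eLpNorm_le_starNorm (hc : ∀ᵐ ω ∂μ, Continuous fun t => f t ω) (t : I) :
    eLpNorm (f t) 2 μ ≤ starNorm μ f := by
  rw [starNorm_eq_eLpNorm_supAbs hc]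
  refine eLpNorm_mono_ae ?_
  filter_upwards [hc] with ω hω
  exact (abs_le_supAbs hω t).trans (le_abs_self _)

theorem starNorm_sub_le (hf : ∀ t, AEStronglyMeasurable (f t) μ)
    (hg : ∀ t, AEStronglyMeasurable (g t) μ) (hfc : ∀ᵐ ω ∂μ, Continuous fun t => f t ω)
    (hgc : ∀ᵐ ω ∂μ, Continuous fun t => g t ω) :
    starNorm μ (fun t ω => f t ω - g t ω) ≤ starNorm μ f + starNorm μ g := by
  have hfgc : ∀ᵐ ω ∂μ, Continuous fun t => f t ω - g t ω := by
    filter_upwards [hfc, hgc] with ω hω hω' using hω.sub hω'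
  rw [starNorm_eq_eLpNorm_supAbs hfc, starNorm_eq_eLpNorm_supAbs hgc,
    starNorm_eq_eLpNorm_supAbs hfgc]
  have hle : ∀ᵐ ω ∂μ, ‖supAbs (fun t ω => f t ω - g t ω) ω‖ ≤ ‖(supAbs f + supAbs g) ω‖ := by
    filter_upwards [hfc, hgc] with ω hω hω'
    rw [Real.norm_of_nonneg (supAbs_nonneg _ ω)]
    refine (supAbs_le fun t => ?_).trans (le_abs_self _)
    exact (abs_sub _ _).trans (add_le_add (abs_le_supAbs hω t) (abs_le_supAbs hω' t))
  exact (eLpNorm_mono_ae hle).trans (eLpNorm_add_le (aestronglyMeasurable_supAbs hf hfc)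
    (aestronglyMeasurable_supAbs hg hgc) one_le_two)

theorem ofReal_integral_mul_le (p q : ℝ≥0∞) [p.HolderConjugate q] {f g : Ω → ℝ}
    (hf : AEStronglyMeasurable f μ) (hg : AEStronglyMeasurable g μ) :
    ENNReal.ofReal (∫ ω, f ω * g ω ∂μ) ≤ eLpNorm f p μ * eLpNorm g q μ :=
  calc ENNReal.ofReal (∫ ω, f ω * g ω ∂μ)
      ≤ ‖∫ ω, f ω * g ω ∂μ‖ₑ := Real.ofReal_le_enorm _
    _ ≤ ∫⁻ ω, ‖f ω * g ω‖ₑ ∂μ := enorm_integral_le_lintegral_enorm _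
    _ = eLpNorm (f • g) 1 μ := eLpNorm_one_eq_lintegral_enorm.symm
    _ ≤ eLpNorm f p μ * eLpNorm g q μ := eLpNorm_smul_le_mul_eLpNorm hg hf

theorem tendsto_integral_gridVariation (hKm : ∀ t, AEStronglyMeasurable (K t) μ)
    (hK : ∀ᵐ ω ∂μ, IsVariationBound (K · ω) (W · ω)) (hW : MemLp (W 1) 2 μ) :
    Tendsto (fun n => ∫ ω, gridVariation n (K · ω) ∂μ) atTop (𝓝 0) := by
  have hmeas (n : ℕ) : AEStronglyMeasurable (fun ω => gridVariation n (K · ω)) μ :=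
    Finset.aestronglyMeasurable_fun_sum _ fun i _ => ((hKm _).sub (hKm _)).pow 2
  rw [← integral_zero Ω ℝ (μ := μ)]
  refine tendsto_integral_of_dominated_convergence (fun ω => W 1 ω ^ 2) hmeas
    hW.integrable_sq (fun n => ?_) (hK.mono fun ω h => h.tendsto_gridVariation)
  filter_upwards [hK] with ω h
  rw [Real.norm_of_nonneg (gridVariation_nonneg _ _)]
  exact h.gridVariation_le n

theorem memLp_of_isVariationBound {p : ℝ≥0∞} (hKm : ∀ t, AEStronglyMeasurable (K t) μ)
    (hK : ∀ᵐ ω ∂μ, IsVariationBound (K · ω) (W · ω)) (hW : MemLp (W 1) p μ) (t : I) :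
    MemLp (K t) p μ :=
  hW.mono (hKm t) <| hK.mono fun _ h => (h.abs_le t).trans (le_abs_self _)

variable [IsFiniteMeasure μ]

namespace IsL2Martingale

theorem integral_sum_mul_sub_eq_zero (hY : IsL2Martingale Y ℱ μ) (hKadp : StronglyAdapted ℱ K)
    (hK : ∀ t, MemLp (K t) 2 μ) {τ : ℕ → I} (hτ : Monotone τ) (n : ℕ) :
    Integrable (fun ω => ∑ i ∈ Finset.range n,
      (K (τ (i + 1)) ω - K (τ i) ω) * (Y 1 ω - Y (τ (i + 1)) ω)) μ ∧
    ∫ ω, ∑ i ∈ Finset.range n,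
      (K (τ (i + 1)) ω - K (τ i) ω) * (Y 1 ω - Y (τ (i + 1)) ω) ∂μ = 0 := by
  have hint (i : ℕ) : Integrable
      (fun ω => (K (τ (i + 1)) ω - K (τ i) ω) * (Y 1 ω - Y (τ (i + 1)) ω)) μ :=
    ((hK _).sub (hK _)).integrable_mul ((hY.memLp _).sub (hY.memLp _))
  refine ⟨integrable_finsetSum _ fun i _ => hint i, ?_⟩
  rw [integral_finsetSum _ fun i _ => hint i]
  exact Finset.sum_eq_zero fun i _ => integral_mul_sub_eq_zero hY.martingale unitInterval.le_one'
    ((hKadp _).sub ((hKadp _).mono (ℱ.mono (hτ i.le_succ)))) (hint i)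

theorem integral_sq_le (hY : IsL2Martingale Y ℱ μ) (hKadp : StronglyAdapted ℱ K)
    (hK : ∀ᵐ ω ∂μ, IsVariationBound (K · ω) (W · ω))
    (hW : MemLp (W 1) 2 μ) {Z : Ω → ℝ} (hYK : ∀ᵐ ω ∂μ, ∀ t, |Y t ω - K t ω| ≤ Z ω)
    (hZ : MemLp Z 2 μ) :
    ∫ ω, Y 1 ω ^ 2 ∂μ ≤ ∫ ω, Z ω ^ 2 ∂μ + 2 * ∫ ω, Z ω * W 1 ω ∂μ := by
  have hKm (t : I) : AEStronglyMeasurable (K t) μ := ((hKadp t).mono (ℱ.le t)).aestronglyMeasurable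
  have hK2 (t : I) : MemLp (K t) 2 μ := memLp_of_isVariationBound hKm hK hW t
  have hVint (n : ℕ) : Integrable (fun ω => gridVariation n (K · ω)) μ :=
    integrable_finsetSum _ fun i _ => ((hK2 _).sub (hK2 _)).integrable_sq
  have hZZ : Integrable (fun ω => Z ω ^ 2) μ := hZ.integrable_sq
  have hZW : Integrable (fun ω => 2 * (Z ω * W 1 ω)) μ := (hZ.integrable_mul hW).const_mul 2
  have hZZW : Integrable (fun ω => Z ω ^ 2 + 2 * (Z ω * W 1 ω)) μ := hZZ.add hZW
  have hbound (n : ℕ) : ∫ ω, Y 1 ω ^ 2 ∂μ ≤ ∫ ω, Z ω ^ 2 ∂μ + 2 * ∫ ω, Z ω * W 1 ω ∂μ +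
      ∫ ω, gridVariation n (K · ω) ∂μ := by
    obtain ⟨hCint, hC⟩ := hY.integral_sum_mul_sub_eq_zero hKadp hK2 (grid_mono n) (n + 1)
    have hV : Integrable (fun ω => Z ω ^ 2 + 2 * (Z ω * W 1 ω) + gridVariation n (K · ω)) μ :=
      hZZW.add (hVint n)
    refine (integral_mono_ae (hY.memLp 1).integrable_sq (hV.add (hCint.const_mul 2)) ?_).trans_eq ?_
    · filter_upwards [hYK, hK] with ω hω hωK using hωK.sq_le hω n
    · rw [integral_add' hV (hCint.const_mul 2), integral_add hZZW (hVint n), integral_add hZZ hZW,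
        integral_const_mul, integral_const_mul, hC, mul_zero, add_zero]
  have hlim := (tendsto_integral_gridVariation hKm hK hW).const_add
    (∫ ω, Z ω ^ 2 ∂μ + 2 * ∫ ω, Z ω * W 1 ω ∂μ)
  rw [add_zero] at hlim
  exact ge_of_tendsto' hlim hbound

theorem eLpNorm_sq_le (hY : IsL2Martingale Y ℱ μ) (hYc : ∀ᵐ ω ∂μ, Continuous fun t => Y t ω)
    (hKadp : StronglyAdapted ℱ K) (hK : ∀ᵐ ω ∂μ, IsVariationBound (K · ω) (W · ω))
    (hW : MemLp (W 1) 2 μ) :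
    eLpNorm (Y 1) 2 μ ^ 2 ≤ starNorm μ (fun t ω => Y t ω - K t ω) ^ 2 +
      2 * (starNorm μ (fun t ω => Y t ω - K t ω) * eLpNorm (W 1) 2 μ) := by
  have hc : ∀ᵐ ω ∂μ, Continuous fun t => Y t ω - K t ω := by
    filter_upwards [hYc, hK] with ω hω hωK using hω.sub hωK.continuous
  have hm (t : I) : AEStronglyMeasurable (fun ω => Y t ω - K t ω) μ :=
    (hY.memLp t).1.sub ((hKadp t).mono (ℱ.le t)).aestronglyMeasurable
  rw [starNorm_eq_eLpNorm_supAbs hc]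
  rcases eq_or_ne (eLpNorm (supAbs fun t ω => Y t ω - K t ω) 2 μ) ∞ with htop | htop
  · simp [htop]
  have hZ : MemLp (supAbs fun t ω => Y t ω - K t ω) 2 μ :=
    ⟨aestronglyMeasurable_supAbs hm hc, htop.lt_top⟩
  have hle : ∀ᵐ ω ∂μ, ∀ t, |Y t ω - K t ω| ≤ supAbs (fun t ω => Y t ω - K t ω) ω :=
    hc.mono fun ω hω => abs_le_supAbs (f := fun t ω => Y t ω - K t ω) hω
  rw [← ofReal_integral_sq (hY.memLp 1), ← ofReal_integral_sq hZ]
  refine (ENNReal.ofReal_le_ofReal (hY.integral_sq_le hKadp hK hW hle hZ)).trans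
    (ENNReal.ofReal_add_le.trans ?_)
  rw [ENNReal.ofReal_mul zero_le_two, ENNReal.ofReal_ofNat]
  gcongr
  exact ofReal_integral_mul_le 2 2 hZ.1 hW.1

theorem starNorm_le_of_sub (hY : IsL2Martingale Y ℱ μ)
    (hYc : ∀ᵐ ω ∂μ, Continuous fun t => Y t ω) (hKm : ∀ t, AEStronglyMeasurable (K t) μ)
    (hKc : ∀ᵐ ω ∂μ, Continuous fun t => K t ω) :
    starNorm μ K ≤ 2 * eLpNorm (Y 1) 2 μ + starNorm μ (fun t ω => Y t ω - K t ω) := by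
  have hc : ∀ᵐ ω ∂μ, Continuous fun t => Y t ω - K t ω := by
    filter_upwards [hYc, hKc] with ω hω hω' using hω.sub hω'
  calc starNorm μ K = starNorm μ (fun t ω => Y t ω - (Y t ω - K t ω)) := by
        simp only [sub_sub_cancel]
    _ ≤ starNorm μ Y + starNorm μ (fun t ω => Y t ω - K t ω) :=
        starNorm_sub_le (fun t => (hY.memLp t).1) (fun t => (hY.memLp t).1.sub (hKm t)) hYc hc
    _ ≤ _ := by gcongr; exact hY.starNorm_le hYc

end IsL2Martingale

end EnergyEstimate

section PathMeasures

variable {d : ℕ} {P : Measure (PathSpace d)} {a : VolBounds d}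

/-- The properties of the measures in `𝒫` on which the estimates rest: the canonical process is a
square integrable martingale, and its quadratic variation has a positive semidefinite density. -/
structure IsAdmissible (P : Measure (PathSpace d)) : Prop where
  isL2Martingale : ∀ k, IsL2Martingale (fun t ω => B t ω k) (canonicalFiltration d) P
  density : IsQuadVarDensity P (quadVarDensity P)
  posSemidef : ∀ᵐ ω ∂P, ∀ᵐ t : I, (quadVarDensity P t ω).PosSemidef

theorem martingale_apply {Ω ι κ : Type*} [Preorder ι] [Fintype κ] {m0 : MeasurableSpace Ω}
    {μ : Measure Ω} {ℱ : Filtration ι m0} {M : ι → Ω → κ → ℝ} (hM : Martingale M ℱ μ) (k : κ) :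
    Martingale (fun t ω => M t ω k) ℱ μ := by
  refine ⟨fun t => (continuous_apply k).comp_stronglyMeasurable (hM.stronglyMeasurable t),
    fun s t hst => ?_⟩
  have hcomm := (ContinuousLinearMap.proj (R := ℝ) (φ := fun _ : κ => ℝ) k).comp_condExp_comm
    (m := ℱ s) (hM.integrable t)
  filter_upwards [hcomm, hM.condExp_ae_eq hst] with ω hω hMω
  rw [← hMω]
  exact hω.symm

theorem posSemidef_maxScalar {A : Matrix (Fin d) (Fin d) ℝ} (hA : A.IsHermitian) {c : ℝ}
    (hc : 0 ≤ c) : (maxScalar hA c).PosSemidef := by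
  refine Matrix.posSemidef_sum _ fun k _ => Matrix.PosSemidef.smul ?_ (le_max_of_le_right hc)
  simpa only [star_trivial] using
    Matrix.posSemidef_vecMulVec_self_star (hA.eigenvectorBasis k).ofLp

theorem posSemidef_of_mem_measureClass (hP : P ∈ measureClass a) :
    ∀ᵐ ω ∂P, ∀ᵐ t : I, (quadVarDensity P t ω).PosSemidef := by
  obtain ⟨-, -, -, c, hc, hbounds⟩ := hP
  filter_upwards [hbounds] with ω hω
  filter_upwards [hω] with t ht
  simpa only [sub_add_cancel] using ht.1.add (posSemidef_maxScalar a.low_nonneg.isHermitian hc.le)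

theorem abs_setIntegral_quadVarDensity_le (hP : P ∈ measureClass a) (t : I) (k : Fin d) :
    ∀ᵐ ω ∂P, |∫ s in Set.Iic t, quadVarDensity P s ω k k| ≤ a.up k k := by
  have hpsd := posSemidef_of_mem_measureClass hP
  obtain ⟨-, -, -, c, -, hbounds⟩ := hP
  filter_upwards [hpsd, hbounds] with ω hω hω'
  have hnorm : ∀ᵐ s : I, ‖quadVarDensity P s ω k k‖ ≤ a.up k k := by
    filter_upwards [hω, hω'] with s hs hs'
    rw [Real.norm_of_nonneg hs.diag_nonneg, ← sub_nonneg]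
    exact hs'.2.diag_nonneg (i := k)
  refine (norm_setIntegral_le_of_norm_le_const_ae (measure_lt_top _ _)
    (ae_restrict_of_ae hnorm)).trans ?_
  exact mul_le_of_le_one_right a.up_pos.posSemidef.diag_nonneg measureReal_le_one

theorem memLp_B_apply (hP : P ∈ measureClass a) (t : I) (k : Fin d) :
    MemLp (fun ω => B t ω k) 2 P := by
  have hbdd := abs_setIntegral_quadVarDensity_le hP t k
  obtain ⟨hprob, hB, hdens, -⟩ := hP
  have hBm : AEStronglyMeasurable (fun ω => B t ω k) P :=
    ((martingale_apply hB k).integrable t).1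
  have hmart := (hdens.martingale k k).integrable t
  have hA : Integrable (fun ω => ∫ s in Set.Iic t, quadVarDensity P s ω k k) P :=
    .of_bound (((hBm.mul hBm).sub hmart.1).congr (ae_of_all _ fun ω => sub_sub_cancel _ _)) _ hbdd
  rw [memLp_two_iff_integrable_sq hBm]
  exact (hmart.add hA).congr (ae_of_all _ fun ω => (sub_add_cancel _ _).trans (sq _).symm)

theorem isAdmissible_of_mem_measureClass (hP : P ∈ measureClass a) : IsAdmissible P where
  isL2Martingale k := ⟨martingale_apply hP.2.1 k, fun t => memLp_B_apply hP t k⟩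
  density := hP.2.2.1
  posSemidef := posSemidef_of_mem_measureClass hP

end PathMeasures

section SimpleIntegrals

variable {d : ℕ} {P : Measure (PathSpace d)}

theorem setIntegral_Iic_min_sub {α : I → ℝ} (hα : Integrable α) {u v : I} (huv : u ≤ v) (t : I) :
    (∫ s in Set.Iic (min t v), α s) - ∫ s in Set.Iic (min t u), α s =
      ∫ s in Set.Iic t, (Set.Ico u v).indicator α s := by
  have hsets : Set.Iic (min t v) \ Set.Iic (min t u) = Set.Iic t ∩ Set.Ioc u v := by
    ext s
    simp only [Set.mem_sdiff, Set.mem_Iic, Set.mem_inter_iff, Set.mem_Ioc, le_min_iff]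
    grind
  rw [← setIntegral_sdiff measurableSet_Iic hα.integrableOn
    (Set.Iic_subset_Iic.2 (min_le_min_left t huv)), hsets, setIntegral_indicator measurableSet_Ico]
  exact setIntegral_congr_set (ae_eq_set_inter (ae_eq_refl _) Ico_ae_eq_Ioc.symm)

namespace SimpleIntegrand

variable (S S' : SimpleIntegrand d) {F A : Fin d → I → PathSpace d → ℝ} {N : I → PathSpace d → ℝ}

/-- The integral of a simple integrand against an arbitrary process with components `F k`. -/
def integralOf (F : Fin d → I → PathSpace d → ℝ) (t : I) (ω : PathSpace d) : ℝ :=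
  ∑ i ∈ Finset.range S.n, ∑ k,
    S.coeff i ω k * (F k (min t (S.time (i + 1))) ω - F k (min t (S.time i)) ω)

theorem integral_eq_integralOf : S.integral = S.integralOf fun k t ω => B t ω k := rfl

theorem integralOf_eq_sum_elemIntegral (F : Fin d → I → PathSpace d → ℝ) :
    S.integralOf F = fun t ω => ∑ i ∈ Finset.range S.n, ∑ k,
      (elemIntegral (S.time i) (fun ω => S.coeff i ω k) (F k) t ω -
        elemIntegral (S.time (i + 1)) (fun ω => S.coeff i ω k) (F k) t ω) := by
  ext t ω
  refine Finset.sum_congr rfl fun i _ => Finset.sum_congr rfl fun k _ => ?_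
  rw [elemIntegral, elemIntegral]
  ring

theorem integralOf_zero_time (F : Fin d → I → PathSpace d → ℝ) (ω : PathSpace d) :
    S.integralOf F 0 ω = 0 := by
  simp [integralOf]

theorem stronglyMeasurable_coeff_apply {i : ℕ} {t : I} (ht : S.time i ≤ t) (k : Fin d) :
    StronglyMeasurable[canonicalFiltration d t] fun ω => S.coeff i ω k :=
  (continuous_apply k).comp_stronglyMeasurable
    ((S.coeff_meas i).mono ((canonicalFiltration d).mono ht))

theorem integralOf_setIntegral {β : Fin d → I → ℝ} (hβ : ∀ k, Integrable (β k)) {ω : PathSpace d}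
    (hF : ∀ k t, F k t ω = ∫ s in Set.Iic t, β k s) (t : I) :
    Integrable (fun s => S.value s ω ⬝ᵥ (β · s)) ∧
    S.integralOf F t ω = ∫ s in Set.Iic t, S.value s ω ⬝ᵥ (β · s) := by
  have hvalue (s : I) : S.value s ω ⬝ᵥ (β · s) = ∑ i ∈ Finset.range S.n, ∑ k,
      S.coeff i ω k * (Set.Ico (S.time i) (S.time (i + 1))).indicator (β k) s := by
    rw [value, sum_dotProduct]
    refine Finset.sum_congr rfl fun i _ => Finset.sum_congr rfl fun k _ => ?_
    by_cases hs : s ∈ Set.Ico (S.time i) (S.time (i + 1)) <;> simp [hs]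
  have hint (i : ℕ) (k : Fin d) : Integrable fun s =>
      S.coeff i ω k * (Set.Ico (S.time i) (S.time (i + 1))).indicator (β k) s :=
    ((hβ k).indicator measurableSet_Ico).const_mul _
  simp only [hvalue]
  refine ⟨integrable_finsetSum _ fun i _ => integrable_finsetSum _ fun k _ => hint i k, ?_⟩
  rw [integral_finsetSum _ fun i _ => integrable_finsetSum _ fun k _ => (hint i k).integrableOn]
  refine Finset.sum_congr rfl fun i _ => ?_
  rw [integral_finsetSum _ fun k _ => (hint i k).integrableOn]
  refine Finset.sum_congr rfl fun k _ => ?_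
  rw [integral_const_mul, hF, hF,
    setIntegral_Iic_min_sub (hβ k) (S.time_mono (Nat.le_add_right i 1))]

/-- The integral of the process `S.value - S'.value` against `F`. -/
def integralOfSub (F : Fin d → I → PathSpace d → ℝ) (t : I) (ω : PathSpace d) : ℝ :=
  S.integralOf F t ω - S'.integralOf F t ω

theorem integralOfSub_setIntegral {β : Fin d → I → ℝ} (hβ : ∀ k, Integrable (β k))
    {ω : PathSpace d} (hF : ∀ k t, F k t ω = ∫ s in Set.Iic t, β k s) (t : I) :
    Integrable (fun s => (S.value - S'.value) s ω ⬝ᵥ (β · s)) ∧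
    S.integralOfSub S' F t ω =
      ∫ s in Set.Iic t, (S.value - S'.value) s ω ⬝ᵥ (β · s) := by
  obtain ⟨hint, hS⟩ := S.integralOf_setIntegral hβ hF t
  obtain ⟨hint', hS'⟩ := S'.integralOf_setIntegral hβ hF t
  simp only [Pi.sub_apply, sub_dotProduct]
  refine ⟨hint.sub hint', ?_⟩
  rw [integralOfSub, hS, hS', integral_sub hint.integrableOn hint'.integrableOn]

theorem energy_value_sub {A : Fin d → Fin d → I → PathSpace d → ℝ} {ω : PathSpace d}
    (hint : ∀ k l, Integrable fun t : I => quadVarDensity P t ω k l)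
    (hpsd : ∀ᵐ t : I, (quadVarDensity P t ω).PosSemidef)
    (hA : ∀ k l t, A k l t ω = ∫ s in Set.Iic t, quadVarDensity P s ω k l) :
    0 ≤ S.integralOfSub S' (fun k => S.integralOfSub S' (A k)) 1 ω ∧
    energy P (S.value - S'.value) ω =
      ENNReal.ofReal (S.integralOfSub S' (fun k => S.integralOfSub S' (A k)) 1 ω) := by
  set V : I → Fin d → ℝ := fun t => (S.value - S'.value) t ω
  have hinner (k : Fin d) := S.integralOfSub_setIntegral S' (hint k) (hA k)
  obtain ⟨hform, houter⟩ := S.integralOfSub_setIntegral S' (fun k => (hinner k 1).1)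
    (fun k t => (hinner k t).2) 1
  have hcomm (t : I) : V t ⬝ᵥ (fun k => V t ⬝ᵥ (quadVarDensity P t ω k ·)) =
      (quadVarDensity P t ω *ᵥ V t) ⬝ᵥ V t := by
    rw [dotProduct_comm]
    exact congrArg (· ⬝ᵥ V t) (funext fun k => dotProduct_comm _ _)
  have hnonneg : ∀ᵐ t : I, 0 ≤ (quadVarDensity P t ω *ᵥ V t) ⬝ᵥ V t := by
    filter_upwards [hpsd] with t ht
    simpa only [star_trivial, dotProduct_comm] using ht.dotProduct_mulVec_nonneg (V t)
  have hvalue : S.integralOfSub S' (fun k => S.integralOfSub S' (A k)) 1 ω =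
      ∫ t, (quadVarDensity P t ω *ᵥ V t) ⬝ᵥ V t := by
    rw [houter, show Set.Iic (1 : I) = Set.univ from Set.Iic_top, setIntegral_univ]
    exact integral_congr_ae (ae_of_all _ hcomm)
  rw [hvalue]
  refine ⟨integral_nonneg_of_ae hnonneg, ?_⟩
  rw [ofReal_integral_eq_lintegral_ofReal (hform.congr (ae_of_all _ hcomm)) hnonneg]
  rfl

variable [IsFiniteMeasure P]

theorem isL2Martingale_integralOf (hF : ∀ k, IsL2Martingale (F k) (canonicalFiltration d) P) :
    IsL2Martingale (S.integralOf F) (canonicalFiltration d) P := by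
  obtain ⟨R, hR⟩ := S.coeff_bdd
  rw [integralOf_eq_sum_elemIntegral]
  exact .sum fun i _ => .sum fun k _ =>
    ((hF k).elemIntegral (S.stronglyMeasurable_coeff_apply le_rfl k) fun ω => hR i ω k).sub
    ((hF k).elemIntegral (S.stronglyMeasurable_coeff_apply (S.time_mono i.le_succ) k)
      fun ω => hR i ω k)

theorem isBracket_integralOf (hF : ∀ k, IsL2Martingale (F k) (canonicalFiltration d) P)
    (hN : IsL2Martingale N (canonicalFiltration d) P)
    (h : ∀ k, IsBracket (canonicalFiltration d) P (F k) N (A k)) :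
    IsBracket (canonicalFiltration d) P (S.integralOf F) N (S.integralOf A) := by
  obtain ⟨R, hR⟩ := S.coeff_bdd
  rw [integralOf_eq_sum_elemIntegral, integralOf_eq_sum_elemIntegral]
  exact .sum fun i _ => .sum fun k _ =>
    ((h k).elemIntegral (hF k) hN (S.stronglyMeasurable_coeff_apply le_rfl k)
      fun ω => hR i ω k).sub
    ((h k).elemIntegral (hF k) hN (S.stronglyMeasurable_coeff_apply (S.time_mono i.le_succ) k)
      fun ω => hR i ω k)

theorem isBracket_integralOfSub (hF : ∀ k, IsL2Martingale (F k) (canonicalFiltration d) P)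
    (hN : IsL2Martingale N (canonicalFiltration d) P)
    (h : ∀ k, IsBracket (canonicalFiltration d) P (F k) N (A k)) :
    IsBracket (canonicalFiltration d) P (S.integralOfSub S' F) N (S.integralOfSub S' A) :=
  (S.isBracket_integralOf hF hN h).sub (S'.isBracket_integralOf hF hN h)

theorem lintegral_energy_value_sub (hP : IsAdmissible P) :
    ∫⁻ ω, energy P (S.value - S'.value) ω ∂P =
      eLpNorm (fun ω => S.integral 1 ω - S'.integral 1 ω) 2 P ^ 2 := by
  let A (k l : Fin d) (t : I) (ω : PathSpace d) : ℝ := ∫ s in Set.Iic t, quadVarDensity P s ω k l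
  let N : I → PathSpace d → ℝ := S.integralOfSub S' fun k t ω => B t ω k
  have hB := hP.isL2Martingale
  have hN : IsL2Martingale N (canonicalFiltration d) P :=
    (S.isL2Martingale_integralOf hB).sub (S'.isL2Martingale_integralOf hB)
  have hbracket : IsBracket (canonicalFiltration d) P N N
      (S.integralOfSub S' fun k => S.integralOfSub S' (A k)) :=
    S.isBracket_integralOfSub S' hB hN fun k => (S.isBracket_integralOfSub S' hB (hB k)
      fun l => IsBracket.symm (hP.density.martingale k l)).symm
  have henergy : ∀ᵐ ω ∂P, 0 ≤ S.integralOfSub S' (fun k => S.integralOfSub S' (A k)) 1 ω ∧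
      energy P (S.value - S'.value) ω =
        ENNReal.ofReal (S.integralOfSub S' (fun k => S.integralOfSub S' (A k)) 1 ω) := by
    filter_upwards [hP.density.integrable, hP.posSemidef] with ω hint hpsd
    exact S.energy_value_sub S' hint hpsd fun _ _ _ => rfl
  rw [lintegral_congr_ae (henergy.mono fun _ h => h.2),
    ← ofReal_integral_eq_lintegral_ofReal (hbracket.integrable hN hN 1)
      (henergy.mono fun _ h => h.1), ← hbracket.integral_mul_eq hN hN (zero_le_one (α := I))
      fun ω => ?_]
  · simp only [← sq]
    exact ofReal_integral_sq (hN.memLp 1)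
  · simp only [N, integralOfSub, integralOf_zero_time, sub_self, mul_zero]

end SimpleIntegrand

end SimpleIntegrals

section EnergyNorm

theorem stronglyMeasurable_uncurry_of_isStronglyProgressive {Ω ι E : Type*} {m0 : MeasurableSpace Ω}
    [Preorder ι] [OrderTop ι] [MeasurableSpace ι] [TopologicalSpace E] {ℱ : Filtration ι m0}
    {Y : ι → Ω → E} (hY : IsStronglyProgressive ℱ Y) :
    StronglyMeasurable fun p : Ω × ι => Y p.2 p.1 := by
  have hm : Measurable[Prod.instMeasurableSpace, @Prod.instMeasurableSpace _ _ _ (ℱ ⊤)]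
      fun p : Ω × ι => ((⟨p.2, le_top⟩ : Set.Iic (⊤ : ι)), p.1) :=
    (measurable_snd.subtype_mk).prodMk (measurable_fst.mono le_rfl (ℱ.le ⊤))
  exact (hY ⊤).comp_measurable hm

theorem sqrt_mulVec_dotProduct_add_le {n : Type*} [Fintype n] {A : Matrix n n ℝ}
    (hA : A.PosSemidef) (x y : n → ℝ) :
    √((A *ᵥ (x + y)) ⬝ᵥ (x + y)) ≤ √((A *ᵥ x) ⬝ᵥ x) + √((A *ᵥ y) ⬝ᵥ y) :=
  @norm_add_le _ (A.toSeminormedAddCommGroup hA).toSeminormedAddGroup x y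

variable {d : ℕ} {P : Measure (PathSpace d)} {H G F : I → PathSpace d → Fin d → ℝ}

/-- The seminorm `|σᵀ H|`, `σ σᵀ = d⟨B⟩/dt`, of an integrand at each path and time. -/
def volatilityNorm (P : Measure (PathSpace d)) (H : I → PathSpace d → Fin d → ℝ)
    (p : PathSpace d × I) : ℝ :=
  √((quadVarDensity P p.2 p.1 *ᵥ H p.2 p.1) ⬝ᵥ H p.2 p.1)

/-- The norm `E^P[∫_0^1 d⟨B⟩_t H_t · H_t]^{1/2}` of an integrand under a single measure `P`. -/
def energyNorm (P : Measure (PathSpace d)) (H : I → PathSpace d → Fin d → ℝ) : ℝ≥0∞ :=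
  (∫⁻ ω, energy P H ω ∂P) ^ (1 / 2 : ℝ)

theorem energyNorm_sq : energyNorm P H ^ 2 = ∫⁻ ω, energy P H ω ∂P := by
  rw [energyNorm, ← ENNReal.rpow_natCast, ← ENNReal.rpow_mul]
  norm_num

theorem energyNorm_sub_self (H : I → PathSpace d → Fin d → ℝ) : energyNorm P (H - H) = 0 := by
  simp [energyNorm, energy]

theorem energyNorm_sub_comm (H G : I → PathSpace d → Fin d → ℝ) :
    energyNorm P (H - G) = energyNorm P (G - H) := by
  have hneg (t : I) (ω : PathSpace d) : (H - G) t ω = -(G - H) t ω := (neg_sub _ _).symm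
  simp only [energyNorm, energy, hneg, Matrix.mulVec_neg, dotProduct_neg, neg_dotProduct, neg_neg]

theorem measurable_value (S : SimpleIntegrand d) :
    Measurable fun p : PathSpace d × I => S.value p.2 p.1 := by
  refine Finset.measurable_sum _ fun i _ => ?_
  have hcoeff : Measurable (S.coeff i) :=
    ((S.coeff_meas i).mono ((canonicalFiltration d).le _)).measurable
  exact (hcoeff.comp measurable_fst).indicator (measurable_snd measurableSet_Ico)

namespace IsAdmissible

theorem measurable_volatilityNorm (hP : IsAdmissible P)
    (hH : Measurable fun p : PathSpace d × I => H p.2 p.1) :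
    Measurable (volatilityNorm P H) := by
  have hHk (k : Fin d) : Measurable fun p : PathSpace d × I => H p.2 p.1 k :=
    (measurable_pi_apply k).comp hH
  refine Measurable.sqrt ?_
  simp only [dotProduct, Matrix.mulVec]
  exact Finset.measurable_fun_sum _ fun i _ => .fun_mul (Finset.measurable_fun_sum _ fun j _ =>
    (stronglyMeasurable_uncurry_of_isStronglyProgressive
      (hP.density.progressive i j)).measurable.fun_mul (hHk j)) (hHk i)

theorem energyNorm_eq_eLpNorm (hP : IsAdmissible P)
    (hH : Measurable fun p : PathSpace d × I => H p.2 p.1) :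
    energyNorm P H = eLpNorm (volatilityNorm P H) 2 (P.prod volume) := by
  have hsq (p : PathSpace d × I) : ‖volatilityNorm P H p‖ₑ ^ (2 : ℝ) =
      ENNReal.ofReal ((quadVarDensity P p.2 p.1 *ᵥ H p.2 p.1) ⬝ᵥ H p.2 p.1) := by
    rw [ENNReal.rpow_two, volatilityNorm, Real.enorm_of_nonneg (Real.sqrt_nonneg _), Real.sqrt,
      ENNReal.ofReal_coe_nnreal, ← ENNReal.coe_pow, NNReal.sq_sqrt, ENNReal.ofReal]
  rw [eLpNorm_eq_lintegral_rpow_enorm_toReal two_ne_zero ENNReal.ofNat_ne_top, lintegral_prod _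
    (((hP.measurable_volatilityNorm hH).enorm.pow_const _).aemeasurable)]
  simp only [ENNReal.toReal_ofNat, hsq, energyNorm, energy]

theorem energyNorm_add_le (hP : IsAdmissible P)
    (hH : Measurable fun p : PathSpace d × I => H p.2 p.1)
    (hG : Measurable fun p : PathSpace d × I => G p.2 p.1) :
    energyNorm P (H + G) ≤ energyNorm P H + energyNorm P G := by
  have hHm := hP.measurable_volatilityNorm hH
  have hGm := hP.measurable_volatilityNorm hG
  have htriangle : ∀ᵐ p ∂P.prod volume,
      volatilityNorm P (H + G) p ≤ volatilityNorm P H p + volatilityNorm P G p := by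
    refine (Measure.ae_prod_iff_ae_ae (measurableSet_le
      (hP.measurable_volatilityNorm (hH.add hG)) (hHm.add hGm))).2 ?_
    filter_upwards [hP.posSemidef] with ω hω
    filter_upwards [hω] with t ht
    exact sqrt_mulVec_dotProduct_add_le ht (H t ω) (G t ω)
  rw [hP.energyNorm_eq_eLpNorm hH, hP.energyNorm_eq_eLpNorm hG,
    hP.energyNorm_eq_eLpNorm (hH.add hG)]
  calc eLpNorm (volatilityNorm P (H + G)) 2 (P.prod volume)
      ≤ eLpNorm (volatilityNorm P H + volatilityNorm P G) 2 (P.prod volume) := by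
        refine eLpNorm_mono_ae (htriangle.mono fun p hp => ?_)
        rw [volatilityNorm, Real.norm_of_nonneg (Real.sqrt_nonneg _)]
        exact hp.trans (le_abs_self _)
    _ ≤ _ := eLpNorm_add_le hHm.aestronglyMeasurable hGm.aestronglyMeasurable one_le_two

theorem energyNorm_sub_le (hP : IsAdmissible P)
    (hH : Measurable fun p : PathSpace d × I => H p.2 p.1)
    (hG : Measurable fun p : PathSpace d × I => G p.2 p.1)
    (hF : Measurable fun p : PathSpace d × I => F p.2 p.1) :
    energyNorm P (H - F) ≤ energyNorm P (H - G) + energyNorm P (G - F) := by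
  rw [← sub_add_sub_cancel H G F]
  exact hP.energyNorm_add_le (hH.sub hG) (hG.sub hF)

theorem energyNorm_value_sub [IsFiniteMeasure P] (hP : IsAdmissible P) (S S' : SimpleIntegrand d) :
    energyNorm P (S.value - S'.value) = eLpNorm (S.integral 1 - S'.integral 1) 2 P := by
  rw [← (ENNReal.pow_right_strictMono two_ne_zero).injective.eq_iff, energyNorm_sq]
  exact S.lintegral_energy_value_sub S' hP

end IsAdmissible

end EnergyNorm

section ItoIntegral

theorem tendsto_zero_of_sq {α : Type*} {l : Filter α} {u : α → ℝ≥0∞}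
    (h : Tendsto (fun x => u x ^ 2) l (𝓝 0)) : Tendsto u l (𝓝 0) := by
  have hroot := (ENNReal.continuous_rpow_const (y := 1 / 2)).tendsto 0 |>.comp h
  rw [ENNReal.zero_rpow_of_pos one_half_pos] at hroot
  refine hroot.congr fun x => ?_
  rw [Function.comp_apply, ← ENNReal.rpow_two, ← ENNReal.rpow_mul]
  norm_num

theorem tendsto_of_triangle {V : Type*} {p : V → Prop} {ρ : V → V → ℝ≥0∞}
    (hself : ∀ x, ρ x x = 0) (hcomm : ∀ x y, ρ x y = ρ y x)
    (htriangle : ∀ {x y z}, p x → p y → p z → ρ x z ≤ ρ x y + ρ y z) {u v : ℕ → V} {x y : V}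
    (hu : ∀ n, p (u n)) (hv : ∀ n, p (v n)) (hx : p x) (hy : p y)
    (hux : Tendsto (fun n => ρ (u n) x) atTop (𝓝 0))
    (hvy : Tendsto (fun n => ρ (v n) y) atTop (𝓝 0)) :
    Tendsto (fun n => ρ (u n) (v n)) atTop (𝓝 (ρ x y)) := by
  let _ : PseudoEMetricSpace {z // p z} :=
    { edist := fun z w => ρ z w
      edist_self := fun z => hself z
      edist_comm := fun z w => hcomm z w
      edist_triangle := fun z w q => htriangle z.2 w.2 q.2 }
  have hux' : Tendsto (fun n => (⟨u n, hu n⟩ : {z // p z})) atTop (𝓝 ⟨x, hx⟩) :=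
    tendsto_iff_edist_tendsto_0.2 hux
  have hvy' : Tendsto (fun n => (⟨v n, hv n⟩ : {z // p z})) atTop (𝓝 ⟨y, hy⟩) :=
    tendsto_iff_edist_tendsto_0.2 hvy
  exact hux'.edist hvy'

theorem eLpNorm_sub_le_add {Ω E : Type*} {m0 : MeasurableSpace Ω} {μ : Measure Ω}
    [NormedAddCommGroup E] {p : ℝ≥0∞} (hp : 1 ≤ p) {f g h : Ω → E}
    (hf : AEStronglyMeasurable f μ) (hg : AEStronglyMeasurable g μ)
    (hh : AEStronglyMeasurable h μ) :
    eLpNorm (f - h) p μ ≤ eLpNorm (f - g) p μ + eLpNorm (g - h) p μ := by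
  rw [← sub_add_sub_cancel f g h]
  exact eLpNorm_add_le (hf.sub hg) (hg.sub hh) hp

theorem eLpNorm_le_eLpNorm_const_add {Ω : Type*} {m0 : MeasurableSpace Ω} {μ : Measure Ω}
    [IsFiniteMeasure μ] {f : Ω → ℝ} (hf : MemLp f 2 μ) (hmean : ∫ ω, f ω ∂μ = 0) (c : ℝ) :
    eLpNorm f 2 μ ≤ eLpNorm (fun ω => c + f ω) 2 μ := by
  have hcf : MemLp (fun ω => c + f ω) 2 μ := (memLp_const c).add hf
  rw [← ENNReal.pow_le_pow_left_iff two_ne_zero, ← ofReal_integral_sq hf, ← ofReal_integral_sq hcf]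
  refine ENNReal.ofReal_le_ofReal ?_
  have hexpand (ω : Ω) : (c + f ω) ^ 2 = c ^ 2 + 2 * c * f ω + f ω ^ 2 := by ring
  have hlin : Integrable (fun ω => 2 * c * f ω) μ := (hf.integrable one_le_two).const_mul _
  have haff : Integrable (fun ω => c ^ 2 + 2 * c * f ω) μ := (integrable_const _).add hlin
  simp only [hexpand]
  rw [integral_add haff hf.integrable_sq, integral_add (integrable_const _) hlin,
    integral_const_mul, hmean, mul_zero, add_zero]
  exact le_add_of_nonneg_left (integral_nonneg fun _ => sq_nonneg c)

variable {d : ℕ} {P : Measure (PathSpace d)} {H H₁ H₂ : I → PathSpace d → Fin d → ℝ}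
  {X X₁ X₂ : I → PathSpace d → ℝ}

theorem isItoIntegral_zero : IsItoIntegral P 0 0 where
  progressive := isStronglyProgressive_const _ _
  continuous := ae_of_all _ fun _ => continuous_const
  approx := by
    let S : SimpleIntegrand d := ⟨0, fun _ => 0, monotone_const, fun _ _ => 0,
      fun _ => stronglyMeasurable_const, 0, fun _ _ _ => abs_zero.le⟩
    refine ⟨fun _ => S, ?_, ?_⟩ <;>
    simp [S, SimpleIntegrand.value, SimpleIntegrand.integral, energy]

theorem SimpleIntegrand.isL2Martingale_integral [IsFiniteMeasure P] (S : SimpleIntegrand d)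
    (hP : IsAdmissible P) : IsL2Martingale S.integral (canonicalFiltration d) P := by
  rw [S.integral_eq_integralOf]
  exact S.isL2Martingale_integralOf hP.isL2Martingale

namespace IsItoIntegral

theorem exists_tendsto (h : IsItoIntegral P H X) : ∃ S : ℕ → SimpleIntegrand d,
    Tendsto (fun n => energyNorm P ((S n).value - H)) atTop (𝓝 0) ∧
    ∀ t, Tendsto (fun n => eLpNorm ((S n).integral t - X t) 2 P) atTop (𝓝 0) := by
  obtain ⟨S, henergy, hsup⟩ := h.approx
  refine ⟨S, tendsto_zero_of_sq (by simpa only [energyNorm_sq] using henergy),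
    fun t => tendsto_zero_of_sq ?_⟩
  refine tendsto_of_tendsto_of_tendsto_of_le_of_le tendsto_const_nhds hsup (fun _ => zero_le)
    fun n => ?_
  rw [← ENNReal.rpow_two]
  calc eLpNorm ((S n).integral t - X t) 2 P ^ (2 : ℝ)
      = ∫⁻ ω, ‖(S n).integral t ω - X t ω‖ₑ ^ (2 : ℝ) ∂P :=
        eLpNorm_nnreal_pow_eq_lintegral (p := 2) two_ne_zero
    _ ≤ ∫⁻ ω, (⨆ t, ‖(S n).integral t ω - X t ω‖ₑ) ^ 2 ∂P := by
        simp only [ENNReal.rpow_two]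
        gcongr with ω
        exact le_iSup (fun t => ‖(S n).integral t ω - X t ω‖ₑ) t

variable [IsFiniteMeasure P]

theorem isL2Martingale (hP : IsAdmissible P) (h : IsItoIntegral P H X) :
    IsL2Martingale X (canonicalFiltration d) P := by
  obtain ⟨S, -, hS⟩ := h.exists_tendsto
  exact .of_tendsto (fun n => (S n).isL2Martingale_integral hP) h.progressive.stronglyAdapted hS

theorem integral_eq_zero (hP : IsAdmissible P) (h : IsItoIntegral P H X) (t : I) :
    ∫ ω, X t ω ∂P = 0 := by
  obtain ⟨S, -, hS⟩ := h.exists_tendsto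
  have hX := h.isL2Martingale hP
  have hzero : X 0 =ᵐ[P] 0 := by
    have hS0 (n : ℕ) : (S n).integral 0 = 0 := by
      ext ω
      rw [(S n).integral_eq_integralOf, (S n).integralOf_zero_time, Pi.zero_apply]
    have hnorm := hS 0
    simp only [hS0, zero_sub, eLpNorm_neg] at hnorm
    exact (eLpNorm_eq_zero_iff (hX.memLp 0).1 two_ne_zero).1
      (tendsto_nhds_unique tendsto_const_nhds hnorm)
  calc ∫ ω, X t ω ∂P = ∫ ω, X 0 ω ∂P := by
        simpa only [setIntegral_univ] using
          (hX.martingale.setIntegral_eq unitInterval.nonneg' MeasurableSet.univ).symm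
    _ = 0 := integral_eq_zero_of_ae hzero

theorem energyNorm_sub_eq (hP : IsAdmissible P)
    (h₁ : IsItoIntegral P H₁ X₁) (h₂ : IsItoIntegral P H₂ X₂)
    (hH₁ : IsProgressiveVec H₁) (hH₂ : IsProgressiveVec H₂) :
    energyNorm P (H₁ - H₂) = eLpNorm (X₁ 1 - X₂ 1) 2 P := by
  obtain ⟨S, hSH, hSX⟩ := h₁.exists_tendsto
  obtain ⟨S', hSH', hSX'⟩ := h₂.exists_tendsto
  have hm₁ := (stronglyMeasurable_uncurry_of_isStronglyProgressive hH₁).measurable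
  have hm₂ := (stronglyMeasurable_uncurry_of_isStronglyProgressive hH₂).measurable
  have hmS (S : SimpleIntegrand d) := ((S.isL2Martingale_integral hP).memLp 1).1
  have henergy : Tendsto (fun n => energyNorm P ((S n).value - (S' n).value)) atTop
      (𝓝 (energyNorm P (H₁ - H₂))) :=
    tendsto_of_triangle (p := fun H => Measurable fun p : PathSpace d × I => H p.2 p.1)
      energyNorm_sub_self energyNorm_sub_comm hP.energyNorm_sub_le
      (fun n => measurable_value (S n)) (fun n => measurable_value (S' n)) hm₁ hm₂ hSH hSH'
  have hintegral : Tendsto (fun n => eLpNorm ((S n).integral 1 - (S' n).integral 1) 2 P) atTop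
      (𝓝 (eLpNorm (X₁ 1 - X₂ 1) 2 P)) :=
    tendsto_of_triangle (ρ := fun f g => eLpNorm (f - g) 2 P) (fun f => by simp)
      (fun f g => eLpNorm_sub_comm f g 2 P) (eLpNorm_sub_le_add one_le_two) (fun n => hmS (S n))
      (fun n => hmS (S' n)) ((h₁.isL2Martingale hP).memLp 1).1 ((h₂.isL2Martingale hP).memLp 1).1
      (hSX 1) (hSX' 1)
  simp only [hP.energyNorm_value_sub] at henergy
  exact tendsto_nhds_unique henergy hintegral

end IsItoIntegral

end ItoIntegral

section SingleMeasure

theorem le_five_mul_of_sq_le {y s k : ℝ≥0∞} (hy : y ≠ ∞) (hsq : y ^ 2 ≤ s ^ 2 + 2 * (s * k))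
    (hk : k ≤ 2 * y + s) : y ≤ 5 * s := by
  rcases eq_or_ne s ∞ with rfl | hs
  · simp
  have hsq' : y ^ 2 ≤ s ^ 2 + 2 * (s * (2 * y + s)) := hsq.trans (by gcongr)
  lift y to ℝ≥0 using hy
  lift s to ℝ≥0 using hs
  norm_cast at hsq' ⊢
  rw [← NNReal.coe_le_coe] at hsq' ⊢
  push_cast at hsq' ⊢
  nlinarith [y.coe_nonneg, s.coe_nonneg]

theorem sq_le_of_le_two_mul_add {y s k : ℝ≥0∞} (hk : k ≤ 2 * y + s) :
    k ^ 2 ≤ 8 * y ^ 2 + 2 * s ^ 2 := by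
  have hadd := ENNReal.rpow_add_le_mul_rpow_add_rpow (2 * y) s one_le_two
  norm_num at hadd
  calc k ^ 2 ≤ (2 * y + s) ^ 2 := by gcongr
    _ ≤ 2 * ((2 * y) ^ 2 + s ^ 2) := hadd
    _ = 8 * y ^ 2 + 2 * s ^ 2 := by ring

section

variable {Ω : Type*} {m0 : MeasurableSpace Ω} {μ : Measure Ω} [IsFiniteMeasure μ]
  {ℱ : Filtration I m0} {Y K W : I → Ω → ℝ}

namespace IsL2Martingale

theorem eLpNorm_le_of_monotone (hY : IsL2Martingale Y ℱ μ)
    (hYc : ∀ᵐ ω ∂μ, Continuous fun t => Y t ω) (hKadp : StronglyAdapted ℱ K)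
    (hK : ∀ᵐ ω ∂μ, IsVariationBound (K · ω) (K · ω)) :
    eLpNorm (Y 1) 2 μ ≤ 5 * starNorm μ (fun t ω => Y t ω - K t ω) := by
  have hKm (t : I) : AEStronglyMeasurable (K t) μ := ((hKadp t).mono (ℱ.le t)).aestronglyMeasurable
  have hKc : ∀ᵐ ω ∂μ, Continuous fun t => K t ω := hK.mono fun _ h => h.continuous
  have hYKc : ∀ᵐ ω ∂μ, Continuous fun t => Y t ω - K t ω := by
    filter_upwards [hYc, hKc] with ω hω hω' using hω.sub hω'
  rcases eq_or_ne (starNorm μ fun t ω => Y t ω - K t ω) ∞ with htop | htop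
  · simp [htop]
  have hYK : MemLp (fun ω => Y 1 ω - K 1 ω) 2 μ := ⟨(hY.memLp 1).1.sub (hKm 1),
    (eLpNorm_le_starNorm (f := fun t ω => Y t ω - K t ω) hYKc 1).trans_lt htop.lt_top⟩
  have hK1 : MemLp (K 1) 2 μ :=
    ((hY.memLp 1).sub hYK).ae_eq (ae_of_all _ fun ω => sub_sub_cancel (Y 1 ω) (K 1 ω))
  exact le_five_mul_of_sq_le (hY.memLp 1).2.ne (hY.eLpNorm_sq_le hYc hKadp hK hK1)
    ((eLpNorm_le_starNorm hKc 1).trans (hY.starNorm_le_of_sub hYc hKm hKc))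

theorem starNorm_le_of_monotone (hY : IsL2Martingale Y ℱ μ)
    (hYc : ∀ᵐ ω ∂μ, Continuous fun t => Y t ω) (hKadp : StronglyAdapted ℱ K)
    (hK : ∀ᵐ ω ∂μ, IsVariationBound (K · ω) (K · ω)) :
    starNorm μ K ≤ 11 * starNorm μ (fun t ω => Y t ω - K t ω) :=
  calc starNorm μ K
      ≤ 2 * eLpNorm (Y 1) 2 μ + starNorm μ (fun t ω => Y t ω - K t ω) :=
        hY.starNorm_le_of_sub hYc (fun t => ((hKadp t).mono (ℱ.le t)).aestronglyMeasurable)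
          (hK.mono fun _ h => h.continuous)
    _ ≤ 2 * (5 * starNorm μ (fun t ω => Y t ω - K t ω)) +
          starNorm μ (fun t ω => Y t ω - K t ω) := by
        gcongr
        exact hY.eLpNorm_le_of_monotone hYc hKadp hK
    _ = 11 * starNorm μ (fun t ω => Y t ω - K t ω) := by ring

theorem starNorm_sq_le (hY : IsL2Martingale Y ℱ μ) (hYc : ∀ᵐ ω ∂μ, Continuous fun t => Y t ω)
    (hKadp : StronglyAdapted ℱ K) (hK : ∀ᵐ ω ∂μ, IsVariationBound (K · ω) (W · ω))
    (hW : MemLp (W 1) 2 μ) :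
    starNorm μ K ^ 2 ≤ 10 * starNorm μ (fun t ω => Y t ω - K t ω) ^ 2 +
      16 * (starNorm μ (fun t ω => Y t ω - K t ω) * eLpNorm (W 1) 2 μ) := by
  set s := starNorm μ (fun t ω => Y t ω - K t ω)
  calc starNorm μ K ^ 2
      ≤ 8 * eLpNorm (Y 1) 2 μ ^ 2 + 2 * s ^ 2 :=
        sq_le_of_le_two_mul_add <| hY.starNorm_le_of_sub hYc
          (fun t => ((hKadp t).mono (ℱ.le t)).aestronglyMeasurable)
          (hK.mono fun _ h => h.continuous)
    _ ≤ 8 * (s ^ 2 + 2 * (s * eLpNorm (W 1) 2 μ)) + 2 * s ^ 2 := by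
        gcongr
        exact hY.eLpNorm_sq_le hYc hKadp hK hW
    _ = 10 * s ^ 2 + 16 * (s * eLpNorm (W 1) 2 μ) := by ring

end IsL2Martingale

end

variable {d : ℕ} {P : Measure (PathSpace d)}
  {H H₁ H₂ : I → PathSpace d → Fin d → ℝ} {X X₁ X₂ K W N : I → PathSpace d → ℝ} {m : ℝ}

namespace IsItoIntegral

theorem continuous_const_add_sub (h₁ : IsItoIntegral P H₁ X₁) (h₂ : IsItoIntegral P H₂ X₂)
    (m : ℝ) : ∀ᵐ ω ∂P, Continuous fun t => m + (X₁ t ω - X₂ t ω) := by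
  filter_upwards [h₁.continuous, h₂.continuous] with ω hω hω' using
    continuous_const.add (hω.sub hω')

variable [IsFiniteMeasure P]

theorem isL2Martingale_const_add_sub (hP : IsAdmissible P) (h₁ : IsItoIntegral P H₁ X₁)
    (h₂ : IsItoIntegral P H₂ X₂) (m : ℝ) :
    IsL2Martingale (fun t ω => m + (X₁ t ω - X₂ t ω)) (canonicalFiltration d) P :=
  (IsL2Martingale.const m).add ((h₁.isL2Martingale hP).sub (h₂.isL2Martingale hP))

theorem energyNorm_sub_le (hP : IsAdmissible P) (h₁ : IsItoIntegral P H₁ X₁)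
    (h₂ : IsItoIntegral P H₂ X₂) (hH₁ : IsProgressiveVec H₁) (hH₂ : IsProgressiveVec H₂) (m : ℝ) :
    energyNorm P (H₁ - H₂) ≤ eLpNorm (fun ω => m + (X₁ 1 ω - X₂ 1 ω)) 2 P := by
  have hX₁ := (h₁.isL2Martingale hP).memLp 1
  have hX₂ := (h₂.isL2Martingale hP).memLp 1
  rw [h₁.energyNorm_sub_eq hP h₂ hH₁ hH₂]
  refine eLpNorm_le_eLpNorm_const_add (hX₁.sub hX₂) ?_ m
  simp only [Pi.sub_apply]
  rw [integral_sub (hX₁.integrable one_le_two) (hX₂.integrable one_le_two),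
    h₁.integral_eq_zero hP, h₂.integral_eq_zero hP, sub_zero]

theorem norms_le (hP : IsAdmissible P) (hX : IsItoIntegral P H X) (hH : IsProgressiveVec H)
    (hKadp : StronglyAdapted (canonicalFiltration d) K)
    (hK : ∀ᵐ ω ∂P, IsVariationBound (K · ω) (K · ω))
    (hN : ∀ᵐ ω ∂P, ∀ t, N t ω = m + X t ω - K t ω) :
    energyNorm P H ≤ 5 * starNorm P N ∧ starNorm P K ≤ 11 * starNorm P N := by
  have hY := hX.isL2Martingale_const_add_sub hP isItoIntegral_zero m
  have hYc := hX.continuous_const_add_sub isItoIntegral_zero m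
  have hN' : starNorm P N = starNorm P fun t ω =>
      m + (X t ω - (0 : I → PathSpace d → ℝ) t ω) - K t ω := by
    refine starNorm_congr ?_
    simpa only [Pi.zero_apply, sub_zero] using hN
  have henergy := hX.energyNorm_sub_le hP isItoIntegral_zero hH
    (isStronglyProgressive_const _ 0) m
  rw [sub_zero] at henergy
  rw [hN']
  exact ⟨henergy.trans (hY.eLpNorm_le_of_monotone hYc hKadp hK),
    hY.starNorm_le_of_monotone hYc hKadp hK⟩

theorem norms_sq_le (hP : IsAdmissible P) (h₁ : IsItoIntegral P H₁ X₁)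
    (h₂ : IsItoIntegral P H₂ X₂) (hH₁ : IsProgressiveVec H₁) (hH₂ : IsProgressiveVec H₂)
    (hKadp : StronglyAdapted (canonicalFiltration d) K)
    (hK : ∀ᵐ ω ∂P, IsVariationBound (K · ω) (W · ω)) (hW : MemLp (W 1) 2 P)
    (hN : ∀ᵐ ω ∂P, ∀ t, N t ω = m + (X₁ t ω - X₂ t ω) - K t ω) :
    energyNorm P (H₁ - H₂) ^ 2 ≤ starNorm P N ^ 2 + 2 * (starNorm P N * eLpNorm (W 1) 2 P) ∧
    starNorm P K ^ 2 ≤ 10 * starNorm P N ^ 2 + 16 * (starNorm P N * eLpNorm (W 1) 2 P) := by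
  have hY := h₁.isL2Martingale_const_add_sub hP h₂ m
  have hYc := h₁.continuous_const_add_sub h₂ m
  rw [starNorm_congr hN]
  exact ⟨(pow_le_pow_left' (h₁.energyNorm_sub_le hP h₂ hH₁ hH₂ m) 2).trans
    (hY.eLpNorm_sq_le hYc hKadp hK hW), hY.starNorm_sq_le hYc hKadp hK hW⟩

end IsItoIntegral

end SingleMeasure

section Supremum

variable {d : ℕ} {a : VolBounds d} {P : Measure (PathSpace d)}
  {H H₁ H₂ : I → PathSpace d → Fin d → ℝ} {K K₁ K₂ : I → PathSpace d → ℝ}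
  {M M₁ M₂ : Measure (PathSpace d) → I → PathSpace d → ℝ} {m m₁ m₂ : ℝ}

theorem iSup₂_rpow_one_half {ι : Type*} {κ : ι → Sort*} (f : ∀ i, κ i → ℝ≥0∞) :
    (⨆ (i) (j), f i j) ^ (1 / 2 : ℝ) = ⨆ (i) (j), f i j ^ (1 / 2 : ℝ) :=
  (ENNReal.orderIsoRpow (1 / 2) one_half_pos).map_iSup₂ f

theorem hNorm_two_eq_iSup (H : I → PathSpace d → Fin d → ℝ) :
    hNorm a 2 H = ⨆ P ∈ measureClass a, energyNorm P H := by
  simp only [hNorm, energyNorm, iSup₂_rpow_one_half, div_self (two_ne_zero (α := ℝ)),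
    ENNReal.rpow_one]

theorem sNormFam_two_eq_iSup (Y : Measure (PathSpace d) → I → PathSpace d → ℝ) :
    sNormFam a 2 Y = ⨆ P ∈ measureClass a, starNorm P (Y P) :=
  iSup₂_rpow_one_half _

theorem starNorm_le_sNormFam (Y : Measure (PathSpace d) → I → PathSpace d → ℝ)
    (hP : P ∈ measureClass a) : starNorm P (Y P) ≤ sNormFam a 2 Y :=
  (le_iSup₂ (f := fun P _ => starNorm P (Y P)) P hP).trans_eq (sNormFam_two_eq_iSup Y).symm

theorem hNorm_sq_le {c : ℝ≥0∞} (h : ∀ P ∈ measureClass a, energyNorm P H ^ 2 ≤ c) :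
    hNorm a 2 H ^ 2 ≤ c := by
  simp only [hNorm_two_eq_iSup, ENNReal.iSup_pow_of_ne_zero two_ne_zero]
  exact iSup₂_le h

theorem sNorm_sq_le {c : ℝ≥0∞} (h : ∀ P ∈ measureClass a, starNorm P K ^ 2 ≤ c) :
    sNorm a 2 K ^ 2 ≤ c := by
  simp only [sNorm, sNormFam_two_eq_iSup, ENNReal.iSup_pow_of_ne_zero two_ne_zero]
  exact iSup₂_le h

namespace MemI

theorem isVariationBound (hK : MemI a 2 K) (hP : P ∈ measureClass a) :
    ∀ᵐ ω ∂P, IsVariationBound (K · ω) (K · ω) := by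
  filter_upwards [hK.continuous P hP, hK.monotone P hP, hK.zero P hP] with ω hc hmono h0 using
    .of_monotone hc hmono h0

theorem eLpNorm_one_le (hK : MemI a 2 K) (hP : P ∈ measureClass a) :
    eLpNorm (K 1) 2 P ≤ sNorm a 2 K :=
  (eLpNorm_le_starNorm (hK.continuous P hP) 1).trans (starNorm_le_sNormFam (fun _ => K) hP)

theorem memLp_one (hK : MemI a 2 K) (hP : P ∈ measureClass a) : MemLp (K 1) 2 P :=
  ⟨((hK.progressive.stronglyAdapted 1).mono ((canonicalFiltration d).le 1)).aestronglyMeasurable,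
    (hK.eLpNorm_one_le hP).trans_lt hK.norm_lt_top⟩

end MemI

namespace IsDecomposition

theorem hNorm_add_sNorm_le (hM : IsDecomposition a M m H K) (hH : IsProgressiveVec H)
    (hKprog : IsProgressive K)
    (hK : ∀ P ∈ measureClass a, ∀ᵐ ω ∂P, IsVariationBound (K · ω) (K · ω)) :
    hNorm a 2 H + sNorm a 2 K ≤ 16 * sNormFam a 2 M := by
  have hbounds (P) (hP : P ∈ measureClass a) :
      energyNorm P H ≤ 5 * sNormFam a 2 M ∧ starNorm P K ≤ 11 * sNormFam a 2 M := by
    have : IsProbabilityMeasure P := hP.1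
    obtain ⟨X, hX, hMX⟩ := hM P hP
    obtain ⟨henergy, hstar⟩ := hX.norms_le (isAdmissible_of_mem_measureClass hP) hH
      hKprog.stronglyAdapted (hK P hP) hMX
    have hMP := starNorm_le_sNormFam M hP
    exact ⟨henergy.trans (by gcongr), hstar.trans (by gcongr)⟩
  calc hNorm a 2 H + sNorm a 2 K ≤ 5 * sNormFam a 2 M + 11 * sNormFam a 2 M := by
        rw [hNorm_two_eq_iSup, sNorm, sNormFam_two_eq_iSup fun _ => K]
        exact add_le_add (iSup₂_le fun P hP => (hbounds P hP).1)
          (iSup₂_le fun P hP => (hbounds P hP).2)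
    _ = 16 * sNormFam a 2 M := by ring

theorem norms_sub_sq_le (hM₁ : IsDecomposition a M₁ m₁ H₁ K₁) (hM₂ : IsDecomposition a M₂ m₂ H₂ K₂)
    (hH₁ : IsProgressiveVec H₁) (hH₂ : IsProgressiveVec H₂) (hK₁ : MemI a 2 K₁)
    (hK₂ : MemI a 2 K₂) (hP : P ∈ measureClass a) :
    energyNorm P (H₁ - H₂) ^ 2 ≤ sNormFam a 2 (M₁ - M₂) ^ 2 +
        2 * (sNormFam a 2 (M₁ - M₂) * (sNorm a 2 K₁ + sNorm a 2 K₂)) ∧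
      starNorm P (K₁ - K₂) ^ 2 ≤ 10 * sNormFam a 2 (M₁ - M₂) ^ 2 +
        16 * (sNormFam a 2 (M₁ - M₂) * (sNorm a 2 K₁ + sNorm a 2 K₂)) := by
  have : IsProbabilityMeasure P := hP.1
  obtain ⟨X₁, hX₁, hMX₁⟩ := hM₁ P hP
  obtain ⟨X₂, hX₂, hMX₂⟩ := hM₂ P hP
  have hN : ∀ᵐ ω ∂P, ∀ t,
      (M₁ - M₂) P t ω = (m₁ - m₂) + (X₁ t ω - X₂ t ω) - (K₁ - K₂) t ω := by
    filter_upwards [hMX₁, hMX₂] with ω hω₁ hω₂ t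
    simp only [Pi.sub_apply, hω₁, hω₂]
    ring
  have hK : ∀ᵐ ω ∂P, IsVariationBound ((K₁ - K₂) · ω) ((K₁ + K₂) · ω) := by
    filter_upwards [hK₁.isVariationBound hP, hK₂.isVariationBound hP] with ω hω₁ hω₂ using
      hω₁.sub hω₂
  obtain ⟨henergy, hstar⟩ := hX₁.norms_sq_le (isAdmissible_of_mem_measureClass hP) hX₂ hH₁ hH₂
    (fun t => (hK₁.progressive.stronglyAdapted t).sub (hK₂.progressive.stronglyAdapted t)) hK
    ((hK₁.memLp_one hP).add (hK₂.memLp_one hP)) hN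
  have hMP := starNorm_le_sNormFam (M₁ - M₂) hP
  have hW : eLpNorm ((K₁ + K₂) 1) 2 P ≤ sNorm a 2 K₁ + sNorm a 2 K₂ :=
    (eLpNorm_add_le (hK₁.memLp_one hP).1 (hK₂.memLp_one hP).1 one_le_two).trans
      (add_le_add (hK₁.eLpNorm_one_le hP) (hK₂.eLpNorm_one_le hP))
  exact ⟨henergy.trans (by gcongr), hstar.trans (by gcongr)⟩

theorem hNorm_sq_add_sNorm_sq_le (hM₁ : IsDecomposition a M₁ m₁ H₁ K₁)
    (hM₂ : IsDecomposition a M₂ m₂ H₂ K₂) (hH₁ : IsProgressiveVec H₁) (hH₂ : IsProgressiveVec H₂)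
    (hK₁ : MemI a 2 K₁) (hK₂ : MemI a 2 K₂) :
    hNorm a 2 (H₁ - H₂) ^ 2 + sNorm a 2 (K₁ - K₂) ^ 2 ≤
      18 * (sNormFam a 2 (M₁ - M₂) ^ 2 +
        sNormFam a 2 (M₁ - M₂) * (sNorm a 2 K₁ + sNorm a 2 K₂)) := by
  have hbounds (P) (hP : P ∈ measureClass a) := hM₁.norms_sub_sq_le hM₂ hH₁ hH₂ hK₁ hK₂ hP
  refine (add_le_add (hNorm_sq_le fun P hP => (hbounds P hP).1)
    (sNorm_sq_le fun P hP => (hbounds P hP).2)).trans ?_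
  set s := sNormFam a 2 (M₁ - M₂)
  set k := sNorm a 2 K₁ + sNorm a 2 K₂
  calc s ^ 2 + 2 * (s * k) + (10 * s ^ 2 + 16 * (s * k)) = 11 * s ^ 2 + 18 * (s * k) := by ring
    _ ≤ 18 * s ^ 2 + 18 * (s * k) := by gcongr; norm_num
    _ = 18 * (s ^ 2 + s * k) := by ring

end IsDecomposition

end Supremum

end GMart

end

theorem proposition5p10_general :
    ∃ C : ℝ≥0, ∀ (d : ℕ) (a : GMart.VolBounds d),
      (∀ (M : Measure (GMart.PathSpace d) → I → GMart.PathSpace d → ℝ) (m : ℝ)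
        (H : I → GMart.PathSpace d → Fin d → ℝ) (K : I → GMart.PathSpace d → ℝ),
        GMart.IsProgressiveVec H → GMart.IsProgressive K →
        (∀ P ∈ GMart.measureClass a, ∀ᵐ ω ∂P,
          Continuous (fun t => K t ω) ∧ Monotone (fun t => K t ω) ∧ K 0 ω = 0) →
        GMart.IsDecomposition a M m H K →
        GMart.hNorm a 2 H + GMart.sNorm a 2 K ≤ C * GMart.sNormFam a 2 M) ∧
      (∀ (M₁ M₂ : Measure (GMart.PathSpace d) → I → GMart.PathSpace d → ℝ) (m₁ m₂ : ℝ)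
        (H₁ H₂ : I → GMart.PathSpace d → Fin d → ℝ) (K₁ K₂ : I → GMart.PathSpace d → ℝ),
        GMart.IsProgressiveVec H₁ → GMart.MemI a 2 K₁ → GMart.IsDecomposition a M₁ m₁ H₁ K₁ →
        GMart.IsProgressiveVec H₂ → GMart.MemI a 2 K₂ → GMart.IsDecomposition a M₂ m₂ H₂ K₂ →
        GMart.hNorm a 2 (H₁ - H₂) ^ 2 + GMart.sNorm a 2 (K₁ - K₂) ^ 2 ≤
          C * (GMart.sNormFam a 2 (M₁ - M₂) ^ 2 +
            GMart.sNormFam a 2 (M₁ - M₂) * (GMart.sNorm a 2 K₁ + GMart.sNorm a 2 K₂))) := by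
  refine ⟨18, fun d a => ⟨fun M m H K hH hKprog hK hM => ?_,
    fun M₁ M₂ m₁ m₂ H₁ H₂ K₁ K₂ hH₁ hK₁ hM₁ hH₂ hK₂ hM₂ =>
      hM₁.hNorm_sq_add_sNorm_sq_le hM₂ hH₁ hH₂ hK₁ hK₂⟩⟩
  have hKbound (P) (hP : P ∈ GMart.measureClass a) :
      ∀ᵐ ω ∂P, GMart.IsVariationBound (K · ω) (K · ω) := by
    filter_upwards [hK P hP] with ω hω using .of_monotone hω.1 hω.2.1 hω.2.2
  exact (hM.hNorm_add_sNorm_le hH hKprog hKbound).trans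
    (mul_le_mul_left (by norm_num) _)

theorem proposition5p10 (d : ℕ) :
    ∃ C : ℝ≥0, ∀ a : GMart.VolBounds d,
      -- one process
      (∀ (M : Measure (GMart.PathSpace d) → I → GMart.PathSpace d → ℝ) (m : ℝ)
        (H : I → GMart.PathSpace d → Fin d → ℝ) (K : I → GMart.PathSpace d → ℝ),
        GMart.MemH a 2 H → GMart.MemI a 2 K → GMart.IsDecomposition a M m H K →
        GMart.hNorm a 2 H + GMart.sNorm a 2 K ≤ C * GMart.sNormFam a 2 M) ∧
      -- differences of two processes
      (∀ (M₁ M₂ : Measure (GMart.PathSpace d) → I → GMart.PathSpace d → ℝ) (m₁ m₂ : ℝ)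
        (H₁ H₂ : I → GMart.PathSpace d → Fin d → ℝ) (K₁ K₂ : I → GMart.PathSpace d → ℝ),
        GMart.MemH a 2 H₁ → GMart.MemI a 2 K₁ → GMart.IsDecomposition a M₁ m₁ H₁ K₁ →
        GMart.MemH a 2 H₂ → GMart.MemI a 2 K₂ → GMart.IsDecomposition a M₂ m₂ H₂ K₂ →
        GMart.hNorm a 2 (H₁ - H₂) ^ 2 + GMart.sNorm a 2 (K₁ - K₂) ^ 2 ≤
          C * (GMart.sNormFam a 2 (M₁ - M₂) ^ 2 +
            GMart.sNormFam a 2 (M₁ - M₂) * (GMart.sNorm a 2 K₁ + GMart.sNorm a 2 K₂))) := by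
  obtain ⟨C, hC⟩ := proposition5p10_general
  refine ⟨C, fun a => ⟨fun M m H K hH hK => (hC d a).1 M m H K hH.progressive hK.progressive ?_,
    fun M₁ M₂ m₁ m₂ H₁ H₂ K₁ K₂ hH₁ hK₁ hM₁ hH₂ =>
      (hC d a).2 M₁ M₂ m₁ m₂ H₁ H₂ K₁ K₂ hH₁.progressive hK₁ hM₁ hH₂.progressive⟩⟩
  exact fun P hP => (hK.continuous P hP).and ((hK.monotone P hP).and (hK.zero P hP))
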